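/- Let $(\Omega,\mathcal F,\{\mathcal F_t\}_{t\ge0},\mathbb P)$ be a stochastic basis with the usual assumptions (complete $\mathcal F_0$, right-continuous filtration), and let $T>0$. Let $W$ be an adapted cylindrical Brownian motion over $L_2((0,\pi))$: a linear map $f\mapsto W_f$ to adapted, almost surely continuous processes $W_f=(W_f(t))_{t\ge0}$, jointly Gaussian with zero mean, such that $\mathbb E\,W_f(t)W_g(s)=\min(t,s)\,(f,g)_{L_2((0,\pi))}$. For $\gamma\in\mathbb R$ let $H^\gamma$ be the Hilbert space of generalized sine series $f=\sqrt{2/\pi}\sum_{k\ge1}f_k\sin(kx)$ with real $f_k$ and $\|f\|_\gamma^2=\sum_{k\ge1}k^{2\gamma}f_k^2<\infty$; for an ordinary function, $f_k=\sqrt{2/\pi}\int_0^\pi f(x)\sin(kx)\,dx$, and $H^0=L_2((0,\pi))$. Write $(f,g)=\sum_{k\ge1}f_kg_k$ for $f\in H^{-1}$, $g\in H^{1}$; for $f,g\in L_2((0,\pi))$ write $(f,g)=\int_0^\pi f(x)g(x)\,dx$. Let $a\ge1$ and $2|b|\le1$, and consider, with zero initial and boundary conditions, $$\frac{\partial^2u}{\partial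 t^2}=a^2\frac{\partial^2u}{\partial x^2}-2b\frac{\partial u}{\partial t}+\dot W(t),\qquad 0<t<T,\ 0<x<\pi .$$ A weak solution is a pair $(u,v)$ of adapted processes on $[0,T]$, with values in $L_2((0,\pi))$ and $H^{-1}$ respectively, such that $u\in L_2(\Omega\times(0,T)\times(0,\pi))$, $v\in L_2(\Omega;L_2((0,T);H^{-1}))$ and, for every $f\in C^2([0,\pi])$ with $f(0)=f(\pi)=0$, with probability one, for all $t\in[0,T]$, $$(u(t),f)=\int_0^t(v(s),f)\,ds,\qquad (v(t),f)=\int_0^t\big(a^2(u(s),f'')-2b\,(v(s),f)\big)ds+W_f(t).$$ **Theorem.** There is a weak solution $(u,v)$, and it is unique: for any weak solution $(u',v')$, with probability one, $u'(t)=u(t)$ and $v'(t)=v(t)$ for all $t\in[0,T]$. Moreover, for every $\gamma<1/2$, $$u\in L_2\big(\Omega;L_2((0,T);H^\gamma)\big),\qquad v\in L_2\big(\Omega;L_2((0,T);H^{\gamma-1})\big).$$ -/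

import Mathlib

open MeasureTheory ProbabilityTheory Set
open scoped NNReal ENNReal

noncomputable section

namespace StochWave

/-! ### Function spaces on `(0, π)` -/

/-- The Hilbert space `L₂((0, π))`. -/
abbrev L2pi : Type := Lp ℝ 2 (volume.restrict (Ioo (0 : ℝ) Real.pi))

/-- The sine coefficients `f_k = √(2/π) ∫_0^π f(x) sin(kx) dx`, `k ≥ 1`. -/
def sineCoeff (f : ℝ → ℝ) (k : ℕ+) : ℝ :=
  Real.sqrt (2 / Real.pi) * ∫ x in Ioo (0 : ℝ) Real.pi, f x * Real.sin ((k : ℝ) * x)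

/-- `‖c‖_γ² = ∑_{k ≥ 1} k^{2γ} c_k²`, with values in `[0, ∞]`, of the generalized sine series
with coefficients `c`. -/
def sobolevNormSq (γ : ℝ) (c : ℕ+ → ℝ) : ℝ≥0∞ :=
  ∑' k : ℕ+, ENNReal.ofReal ((k : ℝ) ^ (2 * γ) * c k ^ 2)

/-- The space `H^γ`: a generalized function `√(2/π) ∑_{k ≥ 1} c_k sin(kx)` is identified with
its sequence `c` of coefficients, and it belongs to `H^γ` when `‖c‖_γ` is finite. -/
def SobolevSpace (γ : ℝ) : Type := {c : ℕ+ → ℝ // sobolevNormSq γ c < ∞}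

/-- The coefficients of an element of `H^γ`. -/
def SobolevSpace.coeff {γ : ℝ} (v : SobolevSpace γ) : ℕ+ → ℝ := v.1

/-- The duality `(v, f) = ∑_{k ≥ 1} v_k f_k` between a generalized function `v`, given by its
coefficients, and a function `f` on `(0, π)`. The series converges absolutely for `v ∈ H^{-1}` and
`f ∈ H^1`. -/
def duality (v : ℕ+ → ℝ) (f : ℝ → ℝ) : ℝ := ∑' k : ℕ+, v k * sineCoeff f k

/-- The test functions: `f ∈ C²([0, π])` with `f(0) = f(π) = 0`. -/
structure IsTestFunction (f : ℝ → ℝ) : Prop where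
  contDiffOn : ContDiffOn ℝ 2 f (Icc 0 Real.pi)
  zero_left : f 0 = 0
  zero_right : f Real.pi = 0

/-- The second derivative `f''` on `[0, π]` (one-sided at the endpoints). -/
def secondDeriv (f : ℝ → ℝ) : ℝ → ℝ := iteratedDerivWithin 2 f (Icc 0 Real.pi)

theorem IsTestFunction.memLp {f : ℝ → ℝ} (hf : IsTestFunction f) :
    MemLp f 2 (volume.restrict (Ioo (0 : ℝ) Real.pi)) := by
  obtain ⟨C, hC⟩ := isCompact_Icc.exists_bound_of_continuousOn hf.contDiffOn.continuousOn
  refine MemLp.of_bound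
    ((hf.contDiffOn.continuousOn.mono Ioo_subset_Icc_self).aestronglyMeasurable
      measurableSet_Ioo) C ?_
  filter_upwards [ae_restrict_mem measurableSet_Ioo] with x hx
  exact hC x (Ioo_subset_Icc_self hx)

/-- A test function, as an element of `L₂((0, π))`. -/
def IsTestFunction.toL2 {f : ℝ → ℝ} (hf : IsTestFunction f) : L2pi := hf.memLp.toLp f

/-! ### Stochastic basis and noise -/

/-- The usual conditions: `𝓕 0` contains all `P`-null sets, and `𝓕` is right-continuous. -/
structure UsualConditions {Ω : Type*} {m : MeasurableSpace Ω} (P : Measure Ω)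
    (𝓕 : Filtration ℝ≥0 m) : Prop where
  complete : ∀ s : Set Ω, P s = 0 → MeasurableSet[𝓕 0] s
  rightContinuous : 𝓕.IsRightContinuous

/-- `W` is an `𝓕`-adapted cylindrical Brownian motion over the real Hilbert space `H`: a linear map
`f ↦ W_f` from `H` to zero-mean Gaussian processes such that
`E (W_f(t) W_g(s)) = min(t, s) (f, g)_H`. As for Brownian motion, the paths of each `W_f` are almost
surely continuous. -/
structure IsCylindricalBrownianMotion {Ω : Type*} {m : MeasurableSpace Ω} {H : Type*}
    [NormedAddCommGroup H] [InnerProductSpace ℝ H] (P : Measure Ω) (𝓕 : Filtration ℝ≥0 m)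
    (W : H → ℝ≥0 → Ω → ℝ) : Prop where
  adapted : ∀ f t, Measurable[𝓕 t] (W f t)
  add : ∀ f g t, W (f + g) t =ᵐ[P] W f t + W g t
  smul : ∀ (r : ℝ) f t, W (r • f) t =ᵐ[P] r • W f t
  gaussian : IsGaussianProcess (fun p : H × ℝ≥0 => W p.1 p.2) P
  mean_zero : ∀ f t, ∫ ω, W f t ω ∂P = 0
  covariance : ∀ f g t s, ∫ ω, W f t ω * W g s ω ∂P = ((min t s : ℝ≥0) : ℝ) * inner ℝ f g
  continuous_paths : ∀ f, ∀ᵐ ω ∂P, Continuous (fun t => W f t ω)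

/-! ### Weak solutions -/

/-- The product measure on `Ω × (0, T)`. -/
def timeMeasure {Ω : Type*} {m : MeasurableSpace Ω} (P : Measure Ω) (T : ℝ) : Measure (Ω × ℝ) :=
  P.prod (volume.restrict (Ioo 0 T))

/-- The process whose sine coefficients are `c t ω` is an element of `L₂(Ω; L₂((0, T); H^γ))`: it
is measurable in `(ω, t)` up to null sets (which, for the separable Hilbert space `H^γ`, is
measurability of each coefficient), and `E ∫_0^T ‖c(t)‖_γ² dt < ∞`. In particular
`c(t) ∈ H^γ` for almost all `(ω, t)`. -/
def MemL2Sobolev {Ω : Type*} {m : MeasurableSpace Ω} (P : Measure Ω) (T γ : ℝ)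
    (c : ℝ → Ω → ℕ+ → ℝ) : Prop :=
  (∀ k, AEMeasurable (fun p : Ω × ℝ => c p.2 p.1 k) (timeMeasure P T)) ∧
    ∫⁻ p : Ω × ℝ, sobolevNormSq γ (c p.2 p.1) ∂(timeMeasure P T) < ∞

/-- `(u, v)` is a weak solution on `[0, T]` of `u_tt = a² u_xx - 2b u_t + Ẇ` on `(0, π)` with zero
initial and boundary conditions, written as the system
`du = v dt`, `dv = (a² u_xx - 2b v) dt + dW(t)`. -/
structure IsWeakSolution {Ω : Type*} {m : MeasurableSpace Ω} (P : Measure Ω)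
    (𝓕 : Filtration ℝ≥0 m) (W : L2pi → ℝ≥0 → Ω → ℝ) (a b T : ℝ)
    (u : ℝ → Ω → L2pi) (v : ℝ → Ω → SobolevSpace (-1)) : Prop where
  adapted_u : ∀ t : ℝ≥0, (t : ℝ) ≤ T → StronglyMeasurable[𝓕 t] (u t)
  adapted_v : ∀ t : ℝ≥0, (t : ℝ) ≤ T → ∀ k, Measurable[𝓕 t] (fun ω => (v t ω).coeff k)
  /-- `u ∈ L₂(Ω × (0, T) × (0, π)) = L₂(Ω × (0, T); L₂((0, π)))` -/
  memL2_u : MemLp (fun p : Ω × ℝ => u p.2 p.1) 2 (timeMeasure P T)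
  /-- `v ∈ L₂(Ω; L₂((0, T); H^{-1}))` -/
  memL2_v : MemL2Sobolev P T (-1) (fun t ω => (v t ω).coeff)
  equations : ∀ (f : ℝ → ℝ) (hf : IsTestFunction f), ∀ᵐ ω ∂P, ∀ t : ℝ≥0, (t : ℝ) ≤ T →
    (∫ x in Ioo (0 : ℝ) Real.pi, u t ω x * f x
        = ∫ s in (0 : ℝ)..t, duality (v s ω).coeff f) ∧
    (duality (v t ω).coeff f
        = (∫ s in (0 : ℝ)..t, (a ^ 2 * (∫ x in Ioo (0 : ℝ) Real.pi, u s ω x * secondDeriv f x)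
            - 2 * b * duality (v s ω).coeff f))
          + W hf.toL2 t ω)

end StochWave

end

namespace StochWave

/-! ### The sine basis of `L₂((0, π))` -/

/-! The normalised sines form a Hilbert basis of `L₂((0, π))`, and testing the equation with them
decouples it: the `k`-th coefficients satisfy `u_k' = v_k` and `dv_k = (-a²k² u_k - 2b v_k) dt +
dw_k`, a damped oscillator driven by the Brownian motion `w_k = W (sineL2 k)`.

Uniqueness: the difference of two weak solutions has coefficients that solve a homogeneous linear
ODE with zero initial data, so they vanish for all times, outside one null set for all `k`;
completeness of the sines concludes for `u`.

Existence: the hypotheses on `a` and `b` make the frequency `κ = √(a²k² - b²)` real and at least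
`k/2`, so each oscillator is solved explicitly through `∫ e^{bs} cos(κs) dw_k` and `∫ e^{bs} sin(κs)
dw_k`. The integrands are smooth, so both integrals are defined path by path by integration by parts
and no Itô theory is needed.

The main estimate is uniform in `k`. An increment of such an integral over `[s, t]` is a limit of
Gaussian sums with variance at most `e^{2T}(t - s)`, so its fourth moment is at most a constant
times `(t - s)²`, whatever `κ` is. Dyadic chaining turns this into random variables `R_k` of bounded
mean with `u_k(t)² ≤ k⁻² R_k` and `v_k(t)² ≤ R_k` for all `t` in `[0, T]`. Hence `∑ k⁻² R_k` is
almost surely finite, which places `u(t)` in `L₂` and `v(t)` in `H⁻¹` for all times at once. Both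
regularity claims reduce to convergence of `∑ k^{2(γ-1)}`, that is, `γ < 1/2`.

For a general test function the equation is the sum of the modal equations with weights `f_k`. Since
`k² f_k` is square summable, dominated convergence exchanges sum and time integral, and the noise
expands as `W_f(t) = ∑ f_k w_k(t)`, simultaneously for all `t`. The carrying lemmas are
`lintegral_pathIntegral_sub_pow_four_le`, `lintegral_chainingBound_le`, `exists_isModalSolution`,
`ae_forall_hasSum` and `eq_zero_of_homogeneous`. -/

theorem integral_Ioo_pi (f : ℝ → ℝ) :
    ∫ x in Ioo (0 : ℝ) Real.pi, f x = ∫ x in (0 : ℝ)..Real.pi, f x := by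
  rw [intervalIntegral.integral_of_le Real.pi_pos.le, integral_Ioc_eq_integral_Ioo]

theorem integral_cos_int_mul (n : ℤ) :
    ∫ x in (0 : ℝ)..Real.pi, Real.cos (n * x) = if n = 0 then Real.pi else 0 := by
  split_ifs with h
  · simp [h]
  · have : (n : ℝ) ≠ 0 := by exact_mod_cast h
    rw [intervalIntegral.integral_comp_mul_left (fun x => Real.cos x) this, integral_cos]
    simp [Real.sin_int_mul_pi]

theorem integral_sin_mul_sin (j k : ℕ+) :
    ∫ x in (0 : ℝ)..Real.pi, Real.sin (j * x) * Real.sin (k * x)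
      = if j = k then Real.pi / 2 else 0 := by
  have h : ∀ x : ℝ, Real.sin (j * x) * Real.sin (k * x)
      = (Real.cos (((j : ℤ) - (k : ℤ) : ℤ) * x) - Real.cos (((j : ℤ) + (k : ℤ) : ℤ) * x)) / 2 := by
    intro x
    push_cast
    rw [sub_mul, add_mul, Real.cos_sub, Real.cos_add]
    ring
  have hi : ∀ n : ℤ, IntervalIntegrable (fun x : ℝ => Real.cos (n * x)) volume 0 Real.pi :=
    fun n => (by fun_prop : Continuous fun x : ℝ => Real.cos (n * x)).intervalIntegrable _ _
  simp only [h]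
  rw [intervalIntegral.integral_div, intervalIntegral.integral_sub (hi _) (hi _),
    integral_cos_int_mul, integral_cos_int_mul]
  have h1 : ((j : ℤ) + (k : ℤ)) ≠ 0 := by positivity
  have h2 : ((j : ℤ) - (k : ℤ) = 0) ↔ j = k := by
    rw [sub_eq_zero]; norm_cast
  simp only [h1, h2, if_false, sub_zero]
  split_ifs <;> simp

/-- The normalised sine `√(2/π) sin(kx)`. -/
noncomputable def sine (k : ℕ+) (x : ℝ) : ℝ := Real.sqrt (2 / Real.pi) * Real.sin (k * x)

theorem contDiff_sine (k : ℕ+) : ContDiff ℝ 2 (sine k) := by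
  unfold sine; fun_prop

theorem isTestFunction_sine (k : ℕ+) : IsTestFunction (sine k) where
  contDiffOn := (contDiff_sine k).contDiffOn
  zero_left := by simp [sine]
  zero_right := by simp [sine, Real.sin_nat_mul_pi]

/-- The normalised sine, as an element of `L₂((0, π))`. -/
noncomputable def sineL2 (k : ℕ+) : L2pi := (isTestFunction_sine k).toL2

theorem coeFn_sineL2 (k : ℕ+) :
    (sineL2 k : ℝ → ℝ) =ᵐ[volume.restrict (Ioo (0 : ℝ) Real.pi)] sine k :=
  (isTestFunction_sine k).memLp.coeFn_toLp

theorem inner_toLp_right (g : L2pi) {f : ℝ → ℝ}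
    (hf : MemLp f 2 (volume.restrict (Ioo (0 : ℝ) Real.pi))) :
    inner ℝ g (hf.toLp f) = ∫ x in Ioo (0 : ℝ) Real.pi, g x * f x := by
  rw [L2.inner_def]
  refine integral_congr_ae ?_
  filter_upwards [hf.coeFn_toLp] with x hx
  rw [hx]
  simp [mul_comm]

theorem integral_mul_sine (f : ℝ → ℝ) (k : ℕ+) :
    ∫ x in Ioo (0 : ℝ) Real.pi, f x * sine k x = sineCoeff f k := by
  rw [sineCoeff, ← integral_const_mul]
  congr 1 with x
  simp only [sine]; ring

theorem sineCoeff_congr {f g : ℝ → ℝ}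
    (h : f =ᵐ[volume.restrict (Ioo (0 : ℝ) Real.pi)] g) : sineCoeff f = sineCoeff g := by
  ext k
  rw [← integral_mul_sine, ← integral_mul_sine]
  refine integral_congr_ae ?_
  filter_upwards [h] with x hx
  rw [hx]

theorem inner_sineL2 (f : L2pi) (k : ℕ+) : inner ℝ (sineL2 k) f = sineCoeff f k := by
  rw [real_inner_comm, sineL2, IsTestFunction.toL2, inner_toLp_right, integral_mul_sine]

theorem sineCoeff_sine (j k : ℕ+) : sineCoeff (sine j) k = if j = k then 1 else 0 := by
  have h : ∀ x : ℝ, sine j x * Real.sin (k * x)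
      = Real.sqrt (2 / Real.pi) * (Real.sin (j * x) * Real.sin (k * x)) := by
    intro x; simp only [sine]; ring
  simp only [sineCoeff, h]
  rw [integral_const_mul, integral_Ioo_pi, integral_sin_mul_sin, ← mul_assoc,
    Real.mul_self_sqrt (by positivity)]
  have := Real.pi_ne_zero
  split_ifs
  · field_simp
  · simp

theorem orthonormal_sineL2 : Orthonormal ℝ sineL2 := by
  rw [orthonormal_iff_ite]
  intro j k
  rw [inner_sineL2, sineCoeff_congr (coeFn_sineL2 k), sineCoeff_sine]
  simp [eq_comm]

/-- Multiplying a sine by `cos x` gives the mean of its two neighbours, so orthogonality to all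
sines survives multiplication by powers of the cosine. The index `k = 0` is included, where the sine
is zero, because the lower neighbour of `k = 1` is needed in the induction. -/
theorem integral_mul_cos_pow_mul_sin_eq_zero {g : ℝ → ℝ}
    (hg : Integrable g (volume.restrict (Ioo (0 : ℝ) Real.pi)))
    (h : ∀ k : ℕ+, ∫ x in Ioo (0 : ℝ) Real.pi, g x * Real.sin (k * x) = 0) (n : ℕ) (k : ℕ) :
    ∫ x in Ioo (0 : ℝ) Real.pi, g x * (Real.cos x ^ n * Real.sin (k * x)) = 0 := by
  have hi : ∀ n k : ℕ, Integrable (fun x => g x * (Real.cos x ^ n * Real.sin (k * x)))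
      (volume.restrict (Ioo (0 : ℝ) Real.pi)) := by
    intro n k
    refine hg.mul_bdd (c := 1) (by fun_prop) (Filter.Eventually.of_forall fun x => ?_)
    rw [norm_mul, norm_pow]
    exact mul_le_one₀ (pow_le_one₀ (norm_nonneg _) (Real.abs_cos_le_one _)) (norm_nonneg _)
      (Real.abs_sin_le_one _)
  induction n generalizing k with
  | zero =>
    rcases Nat.eq_zero_or_pos k with rfl | hk
    · simp
    · simpa using h ⟨k, hk⟩
  | succ n ih =>
    rcases Nat.eq_zero_or_pos k with rfl | hk
    · simp
    obtain ⟨k, rfl⟩ : ∃ l, k = l + 1 := ⟨k - 1, by omega⟩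
    have h2 : ∀ x : ℝ, g x * (Real.cos x ^ (n + 1) * Real.sin ((k + 1 : ℕ) * x))
        = (g x * (Real.cos x ^ n * Real.sin ((k + 2 : ℕ) * x))
          + g x * (Real.cos x ^ n * Real.sin (k * x))) / 2 := by
      intro x
      have e1 : ((k + 2 : ℕ) : ℝ) * x = (k + 1 : ℕ) * x + x := by push_cast; ring
      have e2 : (k : ℝ) * x = (k + 1 : ℕ) * x - x := by push_cast; ring
      rw [e1, e2, Real.sin_add, Real.sin_sub]
      ring
    simp only [h2]
    rw [integral_div, integral_add (hi _ _) (hi _ _), ih, ih]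
    simp

/-- By the case `k = 1` of the previous lemma, `g · sin` is orthogonal to all polynomials in `cos
x`. On `[0, π]` the cosine is invertible, so by Weierstrass these polynomials approximate every
continuous function uniformly. -/
theorem integral_mul_sin_mul_eq_zero {g : ℝ → ℝ}
    (hg : Integrable g (volume.restrict (Ioo (0 : ℝ) Real.pi)))
    (h : ∀ k : ℕ+, ∫ x in Ioo (0 : ℝ) Real.pi, g x * Real.sin (k * x) = 0)
    {φ : ℝ → ℝ} (hφ : Continuous φ) :
    ∫ x in Ioo (0 : ℝ) Real.pi, φ x * (g x * Real.sin x) = 0 := by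
  have hgs : Integrable (fun x => g x * Real.sin x) (volume.restrict (Ioo (0 : ℝ) Real.pi)) :=
    hg.mul_bdd (c := 1) (by fun_prop) (Filter.Eventually.of_forall fun x => Real.abs_sin_le_one _)
  have hpoly : ∀ p : Polynomial ℝ,
      ∫ x in Ioo (0 : ℝ) Real.pi, p.eval (Real.cos x) * (g x * Real.sin x) = 0 := by
    intro p
    simp only [Polynomial.eval_eq_sum_range, Finset.sum_mul]
    rw [integral_finsetSum]
    · refine Finset.sum_eq_zero fun n _ => ?_
      have := integral_mul_cos_pow_mul_sin_eq_zero hg h n 1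
      have e : ∀ x : ℝ, p.coeff n * Real.cos x ^ n * (g x * Real.sin x)
          = p.coeff n * (g x * (Real.cos x ^ n * Real.sin ((1 : ℕ) * x))) := by
        intro x; simp only [Nat.cast_one, one_mul]; ring
      simp only [e]
      rw [integral_const_mul, this, mul_zero]
    · intro n _
      refine hgs.bdd_mul (c := |p.coeff n|) (by fun_prop) (Filter.Eventually.of_forall fun x => ?_)
      rw [norm_mul, norm_pow]
      exact mul_le_of_le_one_right (abs_nonneg _)
        (pow_le_one₀ (norm_nonneg _) (Real.abs_cos_le_one _))
  set I := ∫ x in Ioo (0 : ℝ) Real.pi, φ x * (g x * Real.sin x) with hI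
  set C := ∫ x in Ioo (0 : ℝ) Real.pi, ‖g x * Real.sin x‖ with hC
  have hC0 : 0 ≤ C := integral_nonneg fun x => norm_nonneg _
  obtain ⟨K, hK⟩ := isCompact_Icc.exists_bound_of_continuousOn (s := Icc (0 : ℝ) Real.pi)
    hφ.continuousOn
  have hφi : Integrable (fun x => φ x * (g x * Real.sin x))
      (volume.restrict (Ioo (0 : ℝ) Real.pi)) := by
    refine hgs.bdd_mul (c := K) hφ.aestronglyMeasurable ?_
    filter_upwards [ae_restrict_mem measurableSet_Ioo] with x hx
    exact hK x (Ioo_subset_Icc_self hx)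
  have key : ∀ ε : ℝ, 0 < ε → |I| ≤ ε * C := by
    intro ε hε
    -- Approximating `φ ∘ arccos` on `[-1, 1]` and substituting `y = cos x` approximates `φ` on `(0,
    -- π)`.
    obtain ⟨p, hp⟩ := exists_polynomial_near_of_continuousOn (-1) 1 (fun y => φ (Real.arccos y))
      (hφ.comp Real.continuous_arccos).continuousOn ε hε
    have hpi : Integrable (fun x => p.eval (Real.cos x) * (g x * Real.sin x))
        (volume.restrict (Ioo (0 : ℝ) Real.pi)) := by
      obtain ⟨L, hL⟩ := isCompact_Icc.exists_bound_of_continuousOn (s := Icc (0 : ℝ) Real.pi)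
        (f := fun x => p.eval (Real.cos x))
        (by fun_prop)
      refine hgs.bdd_mul (c := L) (Continuous.aestronglyMeasurable (by fun_prop)) ?_
      filter_upwards [ae_restrict_mem measurableSet_Ioo] with x hx
      exact hL x (Ioo_subset_Icc_self hx)
    have e : I = ∫ x in Ioo (0 : ℝ) Real.pi,
        (φ x * (g x * Real.sin x) - p.eval (Real.cos x) * (g x * Real.sin x)) := by
      rw [integral_sub hφi hpi, hpoly p, sub_zero]
    rw [e, ← Real.norm_eq_abs, hC, ← integral_const_mul]
    refine norm_integral_le_of_norm_le (hgs.norm.const_mul ε) ?_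
    filter_upwards [ae_restrict_mem measurableSet_Ioo] with x hx
    rw [← sub_mul, norm_mul]
    refine mul_le_mul_of_nonneg_right ?_ (norm_nonneg _)
    have := hp (Real.cos x) ⟨Real.neg_one_le_cos x, Real.cos_le_one x⟩
    rw [Real.arccos_cos hx.1.le hx.2.le] at this
    rw [Real.norm_eq_abs, abs_sub_comm]
    exact this.le
  have : |I| ≤ 0 := by
    by_contra! hlt
    have h1 := key (|I| / (2 * (C + 1))) (by positivity)
    have h2 : |I| / (2 * (C + 1)) * C ≤ |I| / 2 := by
      rw [div_mul_eq_mul_div, div_le_div_iff₀ (by positivity) (by norm_num)]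
      nlinarith
    linarith
  exact abs_nonpos_iff.mp this

/-- Completeness of the sines: the fundamental lemma of the calculus of variations kills `g · sin`,
and the sine is positive on `(0, π)`. -/
theorem ae_eq_zero_of_integral_mul_sin_eq_zero {g : ℝ → ℝ}
    (hg : Integrable g (volume.restrict (Ioo (0 : ℝ) Real.pi)))
    (h : ∀ k : ℕ+, ∫ x in Ioo (0 : ℝ) Real.pi, g x * Real.sin (k * x) = 0) :
    g =ᵐ[volume.restrict (Ioo (0 : ℝ) Real.pi)] 0 := by
  have hgs : Integrable (fun x => g x * Real.sin x) (volume.restrict (Ioo (0 : ℝ) Real.pi)) :=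
    hg.mul_bdd (c := 1) (by fun_prop) (Filter.Eventually.of_forall fun x => Real.abs_sin_le_one _)
  have h0 := ae_eq_zero_of_integral_contDiff_smul_eq_zero hgs.locallyIntegrable
    (fun φ hφ _ => integral_mul_sin_mul_eq_zero hg h hφ.continuous)
  filter_upwards [h0, ae_restrict_mem measurableSet_Ioo] with x hx hx'
  exact (mul_eq_zero.mp hx).resolve_right (Real.sin_pos_of_mem_Ioo hx').ne'

theorem eq_zero_of_sineCoeff_eq_zero {g : L2pi} (h : ∀ k, sineCoeff g k = 0) : g = 0 := by
  have hi : Integrable g (volume.restrict (Ioo (0 : ℝ) Real.pi)) :=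
    (Lp.memLp g).integrable (by norm_num)
  rw [Lp.eq_zero_iff_ae_eq_zero]
  refine ae_eq_zero_of_integral_mul_sin_eq_zero hi fun k => ?_
  have := h k
  rw [sineCoeff, mul_eq_zero] at this
  exact this.resolve_left (by have := Real.pi_pos; positivity)

/-- The Hilbert basis `√(2/π) sin(kx)`, `k ≥ 1`, of `L₂((0, π))`. -/
noncomputable def sineBasis : HilbertBasis ℕ+ ℝ L2pi :=
  HilbertBasis.mkOfOrthogonalEqBot orthonormal_sineL2 <| by
    rw [Submodule.eq_bot_iff]
    intro g hg
    refine eq_zero_of_sineCoeff_eq_zero fun k => ?_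
    rw [← inner_sineL2]
    exact (Submodule.mem_orthogonal _ _).mp hg _ (Submodule.subset_span ⟨k, rfl⟩)

theorem coe_sineBasis : (sineBasis : ℕ+ → L2pi) = sineL2 :=
  HilbertBasis.coe_mkOfOrthogonalEqBot _ _

theorem repr_sineBasis (f : L2pi) (k : ℕ+) : sineBasis.repr f k = sineCoeff f k := by
  rw [HilbertBasis.repr_apply_apply, coe_sineBasis, inner_sineL2]

theorem hasSum_sineCoeff_smul (f : L2pi) : HasSum (fun k => sineCoeff f k • sineL2 k) f := by
  simpa only [repr_sineBasis, coe_sineBasis] using sineBasis.hasSum_repr f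

theorem ext_sineCoeff {f g : L2pi} (h : ∀ k, sineCoeff f k = sineCoeff g k) : f = g := by
  refine (hasSum_sineCoeff_smul f).unique ?_
  simp only [h]
  exact hasSum_sineCoeff_smul g

theorem hasSum_sineCoeff_mul (f g : L2pi) :
    HasSum (fun k => sineCoeff f k * sineCoeff g k) (inner ℝ f g) := by
  have := sineBasis.hasSum_inner_mul_inner f g
  simpa only [coe_sineBasis, real_inner_comm (sineL2 _) f, inner_sineL2] using this

theorem hasSum_sineCoeff_sq (f : L2pi) : HasSum (fun k => sineCoeff f k ^ 2) (‖f‖ ^ 2) := by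
  rw [← real_inner_self_eq_norm_sq]
  simpa only [sq] using hasSum_sineCoeff_mul f f

/-- The sum of the sine series with coefficients `c`; it is zero when the series diverges. -/
noncomputable def sineSeries (c : ℕ+ → ℝ) : L2pi := ∑' k, c k • sineL2 k

theorem hasSum_sineSeries {c : ℕ+ → ℝ} (hc : Summable fun k => c k ^ 2) :
    HasSum (fun k => c k • sineL2 k) (sineSeries c) := by
  have hm : Memℓp c 2 := by
    refine memℓp_gen ?_
    simpa using hc
  have := sineBasis.hasSum_repr_symm ⟨c, hm⟩
  rw [coe_sineBasis] at this
  exact this.summable.hasSum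

theorem sineCoeff_sineSeries {c : ℕ+ → ℝ} (hc : Summable fun k => c k ^ 2) (k : ℕ+) :
    sineCoeff (sineSeries c) k = c k := by
  have hm : Memℓp c 2 := by
    refine memℓp_gen ?_
    simpa using hc
  have := sineBasis.hasSum_repr_symm ⟨c, hm⟩
  rw [coe_sineBasis] at this
  rw [sineSeries, this.tsum_eq, ← repr_sineBasis]
  simp

end StochWave

namespace StochWave

/-! ### Test functions -/

theorem IsTestFunction.continuousOn_secondDeriv {f : ℝ → ℝ} (hf : IsTestFunction f) :
    ContinuousOn (secondDeriv f) (Icc 0 Real.pi) :=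
  hf.contDiffOn.continuousOn_iteratedDerivWithin le_rfl (uniqueDiffOn_Icc Real.pi_pos)

theorem memLp_of_continuousOn {f : ℝ → ℝ} (hf : ContinuousOn f (Icc 0 Real.pi)) :
    MemLp f 2 (volume.restrict (Ioo (0 : ℝ) Real.pi)) := by
  obtain ⟨C, hC⟩ := isCompact_Icc.exists_bound_of_continuousOn hf
  refine MemLp.of_bound
    ((hf.mono Ioo_subset_Icc_self).aestronglyMeasurable measurableSet_Ioo) C ?_
  filter_upwards [ae_restrict_mem measurableSet_Ioo] with x hx
  exact hC x (Ioo_subset_Icc_self hx)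

theorem sineCoeff_toLp {f : ℝ → ℝ} (hf : MemLp f 2 (volume.restrict (Ioo (0 : ℝ) Real.pi))) :
    sineCoeff (hf.toLp f) = sineCoeff f :=
  sineCoeff_congr hf.coeFn_toLp

theorem hasSum_sineCoeff_mul_of_memLp (g : L2pi) {f : ℝ → ℝ}
    (hf : MemLp f 2 (volume.restrict (Ioo (0 : ℝ) Real.pi))) :
    HasSum (fun k => sineCoeff g k * sineCoeff f k)
      (∫ x in Ioo (0 : ℝ) Real.pi, g x * f x) := by
  rw [← inner_toLp_right g hf, ← sineCoeff_toLp hf]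
  exact hasSum_sineCoeff_mul _ _

theorem summable_sineCoeff_sq {f : ℝ → ℝ}
    (hf : MemLp f 2 (volume.restrict (Ioo (0 : ℝ) Real.pi))) :
    Summable fun k => sineCoeff f k ^ 2 := by
  rw [← sineCoeff_toLp hf]
  exact (hasSum_sineCoeff_sq _).summable

/-- Two integrations by parts: the first boundary term vanishes because `sin(kx)` does at the
endpoints, the second because `f` does. -/
theorem IsTestFunction.sineCoeff_secondDeriv {f : ℝ → ℝ} (hf : IsTestFunction f) (k : ℕ+) :
    sineCoeff (secondDeriv f) k = -(k : ℝ) ^ 2 * sineCoeff f k := by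
  have hpi := Real.pi_pos
  set s : Set ℝ := Icc 0 Real.pi
  have hs : UniqueDiffOn ℝ s := uniqueDiffOn_Icc hpi
  set f' := derivWithin f s
  have hf1 : DifferentiableOn ℝ f s := hf.contDiffOn.differentiableOn (by norm_num)
  have hf'c : ContDiffOn ℝ 1 f' s := hf.contDiffOn.derivWithin hs (by norm_num)
  have hf2 : DifferentiableOn ℝ f' s := hf'c.differentiableOn (by norm_num)
  have hsec : ∀ x ∈ s, secondDeriv f x = derivWithin f' s x := by
    intro x hx
    rw [secondDeriv, iteratedDerivWithin_succ]
    refine derivWithin_congr (fun y hy => ?_) ?_ <;> simp [f', s]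
  have hu : uIcc 0 Real.pi = s := uIcc_of_le hpi.le
  have d1 : ∀ x ∈ Ioo (0 : ℝ) Real.pi, HasDerivAt f (f' x) x := fun x hx =>
    (hf1 x (Ioo_subset_Icc_self hx)).hasDerivWithinAt.hasDerivAt (Icc_mem_nhds hx.1 hx.2)
  have d2 : ∀ x ∈ Ioo (0 : ℝ) Real.pi, HasDerivAt f' (secondDeriv f x) x := fun x hx => by
    rw [hsec x (Ioo_subset_Icc_self hx)]
    exact (hf2 x (Ioo_subset_Icc_self hx)).hasDerivWithinAt.hasDerivAt (Icc_mem_nhds hx.1 hx.2)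
  have e1 : ∀ x : ℝ, HasDerivAt (fun x => Real.sin (k * x)) (k * Real.cos (k * x)) x := fun x => by
    have := (Real.hasDerivAt_sin (k * x)).comp x ((hasDerivAt_id x).const_mul (k : ℝ))
    simpa [Function.comp_def, mul_comm] using this
  have e2 : ∀ x : ℝ, HasDerivAt (fun x => (k : ℝ) * Real.cos (k * x))
      (-(k : ℝ) ^ 2 * Real.sin (k * x)) x := fun x => by
    have := ((Real.hasDerivAt_cos (k * x)).comp x
      ((hasDerivAt_id x).const_mul (k : ℝ))).const_mul (k : ℝ)
    refine this.congr_deriv ?_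
    simp; ring
  -- This form asks for derivatives only in the open interval and continuity on the closed one, as
  -- suits the one-sided derivatives of `f` at the endpoints.
  have i1 := intervalIntegral.integral_mul_deriv_eq_deriv_mul_of_hasDeriv_right
    (a := 0) (b := Real.pi) (u := fun x => Real.sin (k * x)) (v := f')
    (u' := fun x => (k : ℝ) * Real.cos (k * x)) (v' := secondDeriv f)
    (by fun_prop) (by rw [hu]; exact hf'c.continuousOn)
    (fun x _ => (e1 x).hasDerivWithinAt)
    (fun x hx => (d2 x (by simpa [hpi.le] using hx)).hasDerivWithinAt)
    ((by fun_prop : Continuous _).intervalIntegrable _ _)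
    (ContinuousOn.intervalIntegrable (by rw [hu]; exact hf.continuousOn_secondDeriv))
  have i2 := intervalIntegral.integral_mul_deriv_eq_deriv_mul_of_hasDeriv_right
    (a := 0) (b := Real.pi) (u := fun x => (k : ℝ) * Real.cos (k * x)) (v := f)
    (u' := fun x => -(k : ℝ) ^ 2 * Real.sin (k * x)) (v' := f')
    (by fun_prop) (by rw [hu]; exact hf.contDiffOn.continuousOn)
    (fun x _ => (e2 x).hasDerivWithinAt)
    (fun x hx => (d1 x (by simpa [hpi.le] using hx)).hasDerivWithinAt)
    ((by fun_prop : Continuous _).intervalIntegrable _ _)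
    (ContinuousOn.intervalIntegrable (by rw [hu]; exact hf'c.continuousOn))
  have hsin : Real.sin (k * Real.pi) = 0 := by exact_mod_cast Real.sin_nat_mul_pi k
  rw [hf.zero_left, hf.zero_right] at i2
  rw [hsin] at i1
  simp only [sineCoeff, integral_Ioo_pi]
  have c1 : ∀ g : ℝ → ℝ, ∫ x in (0 : ℝ)..Real.pi, g x * Real.sin (k * x)
      = ∫ x in (0 : ℝ)..Real.pi, Real.sin (k * x) * g x := fun g => by simp only [mul_comm]
  rw [c1, c1, i1, i2]
  simp only [mul_assoc]
  rw [intervalIntegral.integral_const_mul]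
  simp; ring

theorem IsTestFunction.summable_sq {f : ℝ → ℝ} (hf : IsTestFunction f) :
    Summable fun k : ℕ+ => ((k : ℝ) ^ 2 * sineCoeff f k) ^ 2 := by
  have := summable_sineCoeff_sq (memLp_of_continuousOn hf.continuousOn_secondDeriv)
  simpa only [hf.sineCoeff_secondDeriv, neg_mul, neg_sq] using this

end StochWave

namespace StochWave

/-! ### Integrals of smooth functions against continuous paths -/

/-- The integral `∫_0^t φ dw` for a function `φ` with derivative `φ'` and a continuous path `w`,
defined by integration by parts. -/
noncomputable def pathIntegral (φ φ' w : ℝ → ℝ) (t : ℝ) : ℝ :=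
  φ t * w t - ∫ r in (0 : ℝ)..t, φ' r * w r

theorem sum_mul_sub_eq (c w : ℕ → ℝ) (n : ℕ) :
    ∑ i ∈ Finset.range n, c i * (w (i + 1) - w i)
      = c n * w n - c 0 * w 0 - ∑ i ∈ Finset.range n, (c (i + 1) - c i) * w (i + 1) := by
  induction n with
  | zero => simp
  | succ n ih => rw [Finset.sum_range_succ, Finset.sum_range_succ, ih]; ring

/-- Abel summation moves the differences from `w` to `φ`; the sum then differs from the integral of
`φ' w` only by freezing `w` at the right end of each cell, an error controlled by uniform continuity
of `w`. This identifies `pathIntegral` as a limit of elementary stochastic integrals. -/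
theorem tendsto_riemann_sum {φ φ' w : ℝ → ℝ} (hφ : ∀ t, HasDerivAt φ (φ' t) t)
    (hφ' : Continuous φ') (hw : Continuous w) {s t : ℝ} (hst : s < t) :
    Filter.Tendsto (fun n : ℕ => ∑ i ∈ Finset.range (n + 1), φ (s + i * ((t - s) / (n + 1)))
        * (w (s + (i + 1 : ℕ) * ((t - s) / (n + 1))) - w (s + i * ((t - s) / (n + 1)))))
      Filter.atTop (nhds (pathIntegral φ φ' w t - pathIntegral φ φ' w s)) := by
  obtain ⟨L, hL⟩ := isCompact_Icc.exists_bound_of_continuousOn (s := Icc s t) hφ'.continuousOn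
  have hL0 : 0 ≤ L := (norm_nonneg _).trans (hL s ⟨le_rfl, hst.le⟩)
  have huc := isCompact_Icc.uniformContinuousOn_of_continuous (s := Icc s t) hw.continuousOn
  rw [Metric.uniformContinuousOn_iff] at huc
  rw [Metric.tendsto_atTop]
  intro ε hε
  have hd : 0 < t - s := by linarith
  -- The total error is at most `L η (t - s)`; `L + 1` replaces `L` to allow `L = 0`.
  set η := ε / (2 * (L + 1) * (t - s)) with hη
  have hη0 : 0 < η := by positivity
  obtain ⟨δ, hδ, hδw⟩ := huc η hη0
  obtain ⟨N, hN⟩ := exists_nat_gt ((t - s) / δ)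
  refine ⟨N, fun n hn => ?_⟩
  set h := (t - s) / (n + 1) with hh
  have hh0 : 0 < h := by positivity
  have hhδ : h < δ := by
    rw [hh, div_lt_iff₀ (by positivity)]
    rw [div_lt_iff₀ hδ] at hN
    have : (N : ℝ) ≤ n := by exact_mod_cast hn
    nlinarith
  set τ : ℕ → ℝ := fun i => s + i * h with hτ
  have hτ0 : τ 0 = s := by simp [hτ]
  have hτn : τ (n + 1) = t := by simp only [hτ, hh]; push_cast; field_simp; ring
  have hτs : ∀ i, τ (i + 1) = τ i + h := fun i => by simp only [hτ]; push_cast; ring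
  have hmem : ∀ i ≤ n + 1, τ i ∈ Icc s t := by
    intro i hi
    refine ⟨by simp only [hτ]; nlinarith [(Nat.cast_nonneg i : (0 : ℝ) ≤ i)], ?_⟩
    rw [← hτn]
    have : (i : ℝ) ≤ (n + 1 : ℕ) := by exact_mod_cast hi
    simp only [hτ]; nlinarith
  have hci : ∀ a b, IntervalIntegrable (fun r => φ' r * w r) volume a b :=
    fun a b => (hφ'.mul hw).intervalIntegrable a b
  have hc'i : ∀ (c : ℝ) a b, IntervalIntegrable (fun r => φ' r * c) volume a b :=
    fun c a b => (hφ'.mul continuous_const).intervalIntegrable a b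
  have hS : ∑ i ∈ Finset.range (n + 1), φ (τ i) * (w (τ (i + 1)) - w (τ i))
      = φ t * w t - φ s * w s
        - ∑ i ∈ Finset.range (n + 1), ∫ r in τ i..τ (i + 1), φ' r * w (τ (i + 1)) := by
    have := sum_mul_sub_eq (fun i => φ (τ i)) (fun i => w (τ i)) (n + 1)
    rw [this, hτn, hτ0]
    congr 1
    refine Finset.sum_congr rfl fun i _ => ?_
    rw [intervalIntegral.integral_mul_const, intervalIntegral.integral_eq_sub_of_hasDerivAt
      (fun x _ => hφ x) (hφ'.intervalIntegrable _ _)]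
  have hX : pathIntegral φ φ' w t - pathIntegral φ φ' w s
      = φ t * w t - φ s * w s
        - ∑ i ∈ Finset.range (n + 1), ∫ r in τ i..τ (i + 1), φ' r * w r := by
    rw [intervalIntegral.sum_integral_adjacent_intervals (fun k _ => hci _ _), hτn, hτ0,
      pathIntegral, pathIntegral, ← intervalIntegral.integral_interval_sub_left (hci 0 t) (hci 0 s)]
    ring
  change dist (∑ i ∈ Finset.range (n + 1), φ (τ i) * (w (τ (i + 1)) - w (τ i))) _ < ε
  rw [hS, hX, Real.dist_eq, sub_sub_sub_cancel_left, ← Finset.sum_sub_distrib]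
  have hb : ∀ i ∈ Finset.range (n + 1), |(∫ r in τ i..τ (i + 1), φ' r * w r)
      - ∫ r in τ i..τ (i + 1), φ' r * w (τ (i + 1))| ≤ L * η * h := by
    intro i hi
    rw [Finset.mem_range] at hi
    rw [← intervalIntegral.integral_sub (hci _ _) (hc'i _ _ _), ← Real.norm_eq_abs]
    have hle : τ i ≤ τ (i + 1) := by rw [hτs]; linarith
    have := intervalIntegral.norm_integral_le_of_norm_le_const (a := τ i) (b := τ (i + 1))
      (C := L * η) (f := fun r => φ' r * w r - φ' r * w (τ (i + 1))) ?_
    · rwa [hτs, add_sub_cancel_left, abs_of_pos hh0, ← hτs] at this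
    · intro r hr
      rw [uIoc_of_le hle] at hr
      have hr' : r ∈ Icc s t :=
        ⟨(hmem i (by omega)).1.trans hr.1.le, hr.2.trans (hmem (i + 1) (by omega)).2⟩
      rw [← mul_sub, norm_mul]
      refine mul_le_mul (hL r hr') ?_ (norm_nonneg _) hL0
      rw [← dist_eq_norm]
      refine (hδw r hr' _ (hmem (i + 1) (by omega)) ?_).le
      rw [Real.dist_eq, abs_lt]
      constructor <;> linarith [hr.1, hr.2, hτs i]
  calc _ ≤ ∑ i ∈ Finset.range (n + 1), L * η * h :=
        (Finset.abs_sum_le_sum_abs _ _).trans (Finset.sum_le_sum hb)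
    _ = L * η * (t - s) := by
        rw [Finset.sum_const, Finset.card_range, nsmul_eq_mul, hh]; push_cast; field_simp
    _ < ε := by
        rw [hη]
        have : L * (ε / (2 * (L + 1) * (t - s))) * (t - s) = ε * (L / (2 * (L + 1))) := by
          field_simp
        rw [this]
        have : L / (2 * (L + 1)) < 1 := by rw [div_lt_one (by positivity)]; linarith
        nlinarith

/-! ### Fourth moments -/

/-- A standard Brownian motion (without reference to a filtration) with everywhere continuous
paths that start at zero. -/
structure IsBrownian {Ω : Type*} {m : MeasurableSpace Ω} (P : Measure Ω)
    (B : ℝ≥0 → Ω → ℝ) : Prop where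
  measurable : ∀ t, Measurable (B t)
  gaussian : IsGaussianProcess B P
  mean_zero : ∀ t, ∫ ω, B t ω ∂P = 0
  covariance : ∀ t s, ∫ ω, B t ω * B s ω ∂P = ((min t s : ℝ≥0) : ℝ)
  continuous : ∀ ω, Continuous fun t => B t ω
  zero : ∀ ω, B 0 ω = 0

variable {Ω : Type*} {m : MeasurableSpace Ω} {P : Measure Ω}

theorem pow_four_le_exp (x : ℝ) : x ^ 4 ≤ 24 * (Real.exp x + Real.exp (-x)) := by
  have h := Real.pow_div_factorial_le_exp |x| (abs_nonneg x) 4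
  have h4 : |x| ^ 4 = x ^ 4 := by rw [show (4 : ℕ) = 2 * 2 from rfl, pow_mul, pow_mul, sq_abs]
  rw [h4, div_le_iff₀ (by positivity)] at h
  have hf : ((Nat.factorial 4 : ℕ) : ℝ) = 24 := by norm_num [Nat.factorial]
  rw [hf] at h
  have : Real.exp |x| ≤ Real.exp x + Real.exp (-x) := by
    rcases abs_cases x with ⟨h, _⟩ | ⟨h, _⟩ <;> rw [h] <;>
      linarith [Real.exp_pos x, Real.exp_pos (-x)]
  linarith

/-- The constant in the bound of the fourth moment of a Gaussian variable. -/
noncomputable def momentConst : ℝ := 48 * Real.exp (1 / 2)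

theorem momentConst_pos : 0 < momentConst := by unfold momentConst; positivity

/-- After division by `√q` the variance is at most one, so the exponential moments at `±1` are at
most `e^{1/2}`; these dominate the fourth moment by `pow_four_le_exp`. Only an upper bound `q` on
the variance is required, which also covers degenerate laws. -/
theorem lintegral_pow_four_le {Z : Ω → ℝ} (hZ : HasGaussianLaw Z P)
    (h0 : ∫ ω, Z ω ∂P = 0) {q : ℝ} (hq : 0 < q) (hv : ∫ ω, Z ω ^ 2 ∂P ≤ q) :
    ∫⁻ ω, ENNReal.ofReal (Z ω ^ 4) ∂P ≤ ENNReal.ofReal (momentConst * q ^ 2) := by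
  have hmap := hZ.map_eq_gaussianReal
  rw [h0, variance_of_integral_eq_zero hZ.aemeasurable h0] at hmap
  set s := Real.sqrt q with hs
  have hs0 : 0 < s := Real.sqrt_pos.mpr hq
  have hsq : s ^ 2 = q := Real.sq_sqrt hq.le
  have hint : ∀ r : ℝ, Integrable (fun ω => Real.exp (r * Z ω)) P := by
    intro r
    have := integrable_exp_mul_gaussianReal (μ := 0) (v := (∫ ω, Z ω ^ 2 ∂P).toNNReal) r
    rw [← hmap] at this
    exact this.comp_aemeasurable hZ.aemeasurable
  have hexp : ∀ r : ℝ, r ^ 2 * q = 1 → ∫ ω, Real.exp (r * Z ω) ∂P ≤ Real.exp (1 / 2) := by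
    intro r hr
    have := mgf_gaussianReal hmap r
    rw [mgf] at this
    rw [this, Real.exp_le_exp, Real.coe_toNNReal _ (integral_nonneg fun ω => sq_nonneg _)]
    nlinarith [sq_nonneg r]
  have hbd : ∀ ω, Z ω ^ 4 ≤
      q ^ 2 * (24 * (Real.exp (1 / s * Z ω) + Real.exp (-(1 / s) * Z ω))) := by
    intro ω
    have := pow_four_le_exp (1 / s * Z ω)
    have e : Z ω ^ 4 = q ^ 2 * (1 / s * Z ω) ^ 4 := by
      rw [← hsq]; field_simp
    rw [e, neg_mul]
    gcongr
  have hr : (1 / s) ^ 2 * q = 1 := by rw [← hsq]; field_simp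
  have hI : Integrable (fun ω =>
      q ^ 2 * (24 * (Real.exp (1 / s * Z ω) + Real.exp (-(1 / s) * Z ω)))) P :=
    (((hint (1 / s)).add (hint (-(1 / s)))).const_mul 24).const_mul (q ^ 2)
  calc ∫⁻ ω, ENNReal.ofReal (Z ω ^ 4) ∂P
      ≤ ∫⁻ ω, ENNReal.ofReal
        (q ^ 2 * (24 * (Real.exp (1 / s * Z ω) + Real.exp (-(1 / s) * Z ω)))) ∂P :=
        lintegral_mono fun ω => ENNReal.ofReal_le_ofReal (hbd ω)
    _ = ENNReal.ofReal (∫ ω,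
        (q ^ 2 * (24 * (Real.exp (1 / s * Z ω) + Real.exp (-(1 / s) * Z ω)))) ∂P) := by
        rw [ofReal_integral_eq_lintegral_ofReal hI
          (Filter.Eventually.of_forall fun ω => by positivity)]
    _ ≤ _ := by
        refine ENNReal.ofReal_le_ofReal ?_
        rw [integral_const_mul, integral_const_mul, integral_add (hint _) (hint _)]
        have h1 := hexp (1 / s) hr
        have h2 := hexp (-(1 / s)) (by rw [neg_sq]; exact hr)
        have : 0 ≤ q ^ 2 := sq_nonneg q
        rw [momentConst]
        nlinarith

/-! ### Elementary stochastic integrals of deterministic integrands -/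

namespace IsBrownian

variable {B : ℝ≥0 → Ω → ℝ}

theorem integrable_mul (hB : IsBrownian P B) (s t : ℝ≥0) :
    Integrable (fun ω => B s ω * B t ω) P :=
  (hB.gaussian.hasGaussianLaw_eval s).memLp_two.integrable_mul
    (hB.gaussian.hasGaussianLaw_eval t).memLp_two

theorem integral_increment_mul (hB : IsBrownian P B) (p q r s : ℝ≥0) :
    ∫ ω, (B p ω - B q ω) * (B r ω - B s ω) ∂P
      = ((min p r : ℝ≥0) : ℝ) - (min p s : ℝ≥0) - (min q r : ℝ≥0) + (min q s : ℝ≥0) := by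
  have e : ∀ ω, (B p ω - B q ω) * (B r ω - B s ω)
      = B p ω * B r ω - B p ω * B s ω - B q ω * B r ω + B q ω * B s ω := fun ω => by ring
  simp only [e]
  have i := hB.integrable_mul
  have i1 : Integrable (fun ω => B p ω * B r ω - B p ω * B s ω) P := (i p r).sub (i p s)
  have i2 : Integrable (fun ω => B p ω * B r ω - B p ω * B s ω - B q ω * B r ω) P :=
    i1.sub (i q r)
  rw [integral_add i2 (i q s), integral_sub i1 (i q r), integral_sub (i p r) (i p s)]
  simp only [hB.covariance]

/-- The second moment of an elementary stochastic integral. -/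
theorem integral_sum_sq (hB : IsBrownian P B) (c : ℕ → ℝ) {τ : ℕ → ℝ≥0} (hτ : Monotone τ) (n : ℕ) :
    ∫ ω, (∑ i ∈ Finset.range n, c i * (B (τ (i + 1)) ω - B (τ i) ω)) ^ 2 ∂P
      = ∑ i ∈ Finset.range n, c i ^ 2 * ((τ (i + 1) : ℝ) - τ i) := by
  have hL : ∀ i, MemLp (fun ω => B (τ (i + 1)) ω - B (τ i) ω) 2 P := fun i =>
    (hB.gaussian.hasGaussianLaw_eval _).memLp_two.sub (hB.gaussian.hasGaussianLaw_eval _).memLp_two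
  have hLs : ∀ n, MemLp (fun ω => ∑ i ∈ Finset.range n, c i * (B (τ (i + 1)) ω - B (τ i) ω)) 2 P :=
    fun n => memLp_finsetSum _ fun i _ => (hL i).const_mul (c i)
  induction n with
  | zero => simp
  | succ n ih =>
    have e : ∀ ω, (∑ i ∈ Finset.range (n + 1), c i * (B (τ (i + 1)) ω - B (τ i) ω)) ^ 2
        = (∑ i ∈ Finset.range n, c i * (B (τ (i + 1)) ω - B (τ i) ω)) ^ 2
          + 2 * c n * (∑ i ∈ Finset.range n,
            c i * ((B (τ (i + 1)) ω - B (τ i) ω) * (B (τ (n + 1)) ω - B (τ n) ω)))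
          + c n ^ 2 * ((B (τ (n + 1)) ω - B (τ n) ω) * (B (τ (n + 1)) ω - B (τ n) ω)) := by
      intro ω
      rw [Finset.sum_range_succ]
      simp only [← mul_assoc, ← Finset.sum_mul]
      ring
    simp only [e]
    have i1 : ∀ i, Integrable (fun ω => c i *
        ((B (τ (i + 1)) ω - B (τ i) ω) * (B (τ (n + 1)) ω - B (τ n) ω))) P :=
      fun i => ((hL i).integrable_mul (hL n)).const_mul _
    have i2 : Integrable (fun ω => ∑ i ∈ Finset.range n, c i *
        ((B (τ (i + 1)) ω - B (τ i) ω) * (B (τ (n + 1)) ω - B (τ n) ω))) P :=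
      integrable_finsetSum _ fun i _ => i1 i
    have i3 : Integrable (fun ω =>
        (∑ i ∈ Finset.range n, c i * (B (τ (i + 1)) ω - B (τ i) ω)) ^ 2
          + 2 * c n * (∑ i ∈ Finset.range n,
            c i * ((B (τ (i + 1)) ω - B (τ i) ω) * (B (τ (n + 1)) ω - B (τ n) ω)))) P :=
      (hLs n).integrable_sq.add (i2.const_mul _)
    have i4 : Integrable (fun ω =>
        c n ^ 2 * ((B (τ (n + 1)) ω - B (τ n) ω) * (B (τ (n + 1)) ω - B (τ n) ω))) P :=
      ((hL n).integrable_mul (hL n)).const_mul _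
    rw [integral_add i3 i4, integral_add (hLs n).integrable_sq (i2.const_mul _),
      integral_const_mul, integral_const_mul,
      integral_finsetSum _ (fun i _ => i1 i), ih, Finset.sum_range_succ,
      hB.integral_increment_mul]
    -- Increments over disjoint intervals are uncorrelated, so the cross terms vanish.
    have z : ∑ i ∈ Finset.range n, ∫ ω, c i *
        ((B (τ (i + 1)) ω - B (τ i) ω) * (B (τ (n + 1)) ω - B (τ n) ω)) ∂P = 0 := by
      refine Finset.sum_eq_zero fun i hi => ?_
      rw [Finset.mem_range] at hi
      have h1 : τ (i + 1) ≤ τ n := hτ hi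
      have h2 : τ i ≤ τ n := hτ hi.le
      have h3 : τ n ≤ τ (n + 1) := hτ n.le_succ
      rw [integral_const_mul, hB.integral_increment_mul, min_eq_left (h1.trans h3),
        min_eq_left h1, min_eq_left (h2.trans h3), min_eq_left h2]
      ring
    have h3 : τ n ≤ τ (n + 1) := hτ n.le_succ
    rw [z, min_self, min_self, min_eq_right h3, min_eq_left h3]
    ring

theorem hasGaussianLaw_sum (hB : IsBrownian P B) (c : ℕ → ℝ) (τ : ℕ → ℝ≥0) (n : ℕ) :
    HasGaussianLaw
      (fun ω => ∑ i ∈ Finset.range n, c i * (B (τ (i + 1)) ω - B (τ i) ω)) P := by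
  have h := hB.gaussian.hasGaussianLaw_increments (n := n) (t := fun i => τ i)
  have := h.map_fun (∑ i : Fin n, c i • ContinuousLinearMap.proj (R := ℝ) (φ := fun _ => ℝ) i)
  refine this.congr (Filter.Eventually.of_forall fun ω => ?_)
  simp [Finset.sum_range]

theorem integral_sum_eq_zero (hB : IsBrownian P B) (c : ℕ → ℝ) (τ : ℕ → ℝ≥0) (n : ℕ) :
    ∫ ω, ∑ i ∈ Finset.range n, c i * (B (τ (i + 1)) ω - B (τ i) ω) ∂P = 0 := by
  have hi : ∀ t, Integrable (B t) P := fun t => (hB.gaussian.hasGaussianLaw_eval t).integrable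
  have hd : ∀ i, Integrable (fun ω => c i * (B (τ (i + 1)) ω - B (τ i) ω)) P :=
    fun i => ((hi _).sub (hi _)).const_mul _
  rw [integral_finsetSum _ fun i _ => hd i]
  refine Finset.sum_eq_zero fun i _ => ?_
  rw [integral_const_mul, integral_sub (hi _) (hi _), hB.mean_zero, hB.mean_zero]
  simp

theorem lintegral_sum_pow_four_le (hB : IsBrownian P B) {c : ℕ → ℝ} {τ : ℕ → ℝ≥0}
    (hτ : Monotone τ) {K : ℝ} (hK : 0 < K) {n : ℕ} (hc : ∀ i < n, |c i| ≤ K) (hn : τ 0 < τ n) :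
    ∫⁻ ω, ENNReal.ofReal ((∑ i ∈ Finset.range n, c i * (B (τ (i + 1)) ω - B (τ i) ω)) ^ 4) ∂P
      ≤ ENNReal.ofReal (momentConst * (K ^ 2 * ((τ n : ℝ) - τ 0)) ^ 2) := by
  have hn' : (0 : ℝ) < (τ n : ℝ) - τ 0 := sub_pos.mpr (by exact_mod_cast hn)
  refine lintegral_pow_four_le (hB.hasGaussianLaw_sum c τ n) (hB.integral_sum_eq_zero c τ n)
    (by positivity) ?_
  rw [hB.integral_sum_sq c hτ, ← Finset.sum_range_sub (fun i => (τ i : ℝ)) n, Finset.mul_sum]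
  refine Finset.sum_le_sum fun i hi => ?_
  have h1 : (τ i : ℝ) ≤ τ (i + 1) := by exact_mod_cast hτ i.le_succ
  refine mul_le_mul_of_nonneg_right ?_ (sub_nonneg.mpr h1)
  rw [← sq_abs (c i)]
  have := hc i (Finset.mem_range.mp hi)
  gcongr

/-- The path of a Brownian motion, extended by `0` to negative times. -/
def path (B : ℝ≥0 → Ω → ℝ) (ω : Ω) (t : ℝ) : ℝ := B t.toNNReal ω

theorem continuous_path (hB : IsBrownian P B) (ω : Ω) : Continuous (path B ω) :=
  (hB.continuous ω).comp continuous_real_toNNReal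

theorem path_zero (hB : IsBrownian P B) (ω : Ω) : path B ω 0 = 0 := by
  simp [path, hB.zero]

/-- The bound for elementary integrals passes to the limit by Fatou's lemma. It involves only the
supremum of `|φ|` and not `φ'`, which makes the later estimates uniform in the frequency. -/
theorem lintegral_pathIntegral_sub_pow_four_le (hB : IsBrownian P B) {φ φ' : ℝ → ℝ}
    (hφ : ∀ t, HasDerivAt φ (φ' t) t) (hφ' : Continuous φ') {T K : ℝ} (hK : 0 < K)
    (hφK : ∀ t ∈ Icc 0 T, |φ t| ≤ K) {s t : ℝ} (hs : 0 ≤ s) (hst : s < t) (ht : t ≤ T) :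
    ∫⁻ ω, ENNReal.ofReal
        ((pathIntegral φ φ' (path B ω) t - pathIntegral φ φ' (path B ω) s) ^ 4) ∂P
      ≤ ENNReal.ofReal (momentConst * (K ^ 2 * (t - s)) ^ 2) := by
  set Z : ℕ → Ω → ℝ := fun n ω =>
    ∑ i ∈ Finset.range (n + 1), φ (s + i * ((t - s) / (n + 1)))
        * (path B ω (s + (i + 1 : ℕ) * ((t - s) / (n + 1)))
          - path B ω (s + i * ((t - s) / (n + 1)))) with hZ
  have hd : 0 < t - s := by linarith
  have hlim : ∀ ω, Filter.Tendsto (fun n => ENNReal.ofReal (Z n ω ^ 4)) Filter.atTop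
      (nhds (ENNReal.ofReal
        ((pathIntegral φ φ' (path B ω) t - pathIntegral φ φ' (path B ω) s) ^ 4))) := fun ω =>
    ENNReal.tendsto_ofReal ((tendsto_riemann_sum hφ hφ' (hB.continuous_path ω) hst).pow 4)
  have hmeas : ∀ n, Measurable (Z n) := fun n =>
    Finset.measurable_sum _ fun i _ =>
      ((hB.measurable _).sub (hB.measurable _)).const_mul _
  have hbd : ∀ n, ∫⁻ ω, ENNReal.ofReal (Z n ω ^ 4) ∂P
      ≤ ENNReal.ofReal (momentConst * (K ^ 2 * (t - s)) ^ 2) := by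
    intro n
    have hh : 0 ≤ (t - s) / (n + 1) := by positivity
    have hend : ((n + 1 : ℕ) : ℝ) * ((t - s) / (n + 1)) = t - s := by push_cast; field_simp
    simp only [hZ]
    generalize (t - s) / ((n : ℝ) + 1) = h at hh hend
    have hτ : Monotone fun i : ℕ => (s + i * h).toNNReal := by
      intro i j hij
      refine Real.toNNReal_le_toNNReal ?_
      have : (i : ℝ) ≤ j := by exact_mod_cast hij
      gcongr
    have hlast : ((s + (n + 1 : ℕ) * h).toNNReal : ℝ) = t := by
      rw [hend, Real.coe_toNNReal _ (by linarith)]; ring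
    have hfirst : ((s + (0 : ℕ) * h).toNNReal : ℝ) = s := by
      rw [Nat.cast_zero, zero_mul, add_zero, Real.coe_toNNReal _ hs]
    have := hB.lintegral_sum_pow_four_le (c := fun i => φ (s + i * h)) hτ hK (n := n + 1)
      (fun i hi => hφK _ ⟨by positivity, ?_⟩) ?_
    · simp only [hlast, hfirst] at this
      exact this
    · have : (i : ℝ) ≤ (n + 1 : ℕ) := by exact_mod_cast hi.le
      nlinarith
    · rw [← NNReal.coe_lt_coe, hlast, hfirst]
      exact hst
  calc _ = ∫⁻ ω, Filter.liminf (fun n => ENNReal.ofReal (Z n ω ^ 4)) Filter.atTop ∂P :=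
        lintegral_congr fun ω => (hlim ω).liminf_eq.symm
    _ ≤ Filter.liminf (fun n => ∫⁻ ω, ENNReal.ofReal (Z n ω ^ 4) ∂P) Filter.atTop :=
        lintegral_liminf_le fun n => ((hmeas n).pow_const 4).ennreal_ofReal
    _ ≤ _ := by
        refine (Filter.liminf_le_liminf (Filter.Eventually.of_forall hbd)).trans ?_
        simp

end IsBrownian

end StochWave

namespace StochWave

/-! ### A maximal inequality by dyadic chaining -/

/-- The sum of the fourth powers of the increments over the dyadic intervals of level `n`. -/
noncomputable def dyadicSum (T : ℝ) (x : ℝ → ℝ) (n : ℕ) : ℝ :=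
  ∑ j ∈ Finset.range (2 ^ n), (x ((j + 1 : ℕ) * (T / 2 ^ n)) - x (j * (T / 2 ^ n))) ^ 4

theorem dyadicSum_nonneg (T : ℝ) (x : ℝ → ℝ) (n : ℕ) : 0 ≤ dyadicSum T x n :=
  Finset.sum_nonneg fun _ _ => by positivity

/-- One step of the weighted Cauchy–Schwarz inequality `(∑ d_i)² ≤ (∑ α_i)(∑ y_i)` for `d_i² ≤ α_i
y_i`, in a form suited to induction. -/
theorem sq_add_le_mul {x d A B α y : ℝ} (hA : 0 < A) (hα : 0 < α) (hx : x ^ 2 ≤ A * B)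
    (hd : d ^ 2 ≤ α * y) : (x + d) ^ 2 ≤ (A + α) * (B + y) := by
  have h1 : 0 ≤ (α * x - A * d) ^ 2 := sq_nonneg _
  have h2 : 2 * (x * d) ≤ α * B + A * y := by
    have : 2 * (x * d) * (A * α) ≤ (α * B + A * y) * (A * α) := by
      nlinarith [mul_le_mul_of_nonneg_left hx (sq_nonneg α),
        mul_le_mul_of_nonneg_left hd (sq_nonneg A)]
    exact le_of_mul_le_mul_right this (by positivity)
  nlinarith

/-- The summands of the chaining bound. -/
noncomputable def chainingTerm (T : ℝ) (x : ℝ → ℝ) (i : ℕ) : ℝ :=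
  (6 / 7) ^ i + (32 / 21) ^ i * dyadicSum T x i

theorem chainingTerm_nonneg (T : ℝ) (x : ℝ → ℝ) (i : ℕ) : 0 ≤ chainingTerm T x i := by
  have := dyadicSum_nonneg T x i
  unfold chainingTerm; positivity

/-- Since `d² ≤ p + p⁻¹ d⁴`, taking `p = (3/4)^n` and extracting the summable weight `(7/8)^n`
leaves the factors `6/7` and `32/21` of `chainingTerm`. The expected dyadic sum decays like `2⁻ⁿ`,
so the second factor becomes `16/21 < 1` in expectation. -/
theorem sq_increment_le (T : ℝ) (x : ℝ → ℝ) {n j : ℕ} (hj : j < 2 ^ n) :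
    (x ((j + 1 : ℕ) * (T / 2 ^ n)) - x (j * (T / 2 ^ n))) ^ 2
      ≤ (7 / 8) ^ n * chainingTerm T x n := by
  set d := x ((j + 1 : ℕ) * (T / 2 ^ n)) - x (j * (T / 2 ^ n)) with hd
  have h1 : d ^ 4 ≤ dyadicSum T x n :=
    Finset.single_le_sum (f := fun j : ℕ =>
      (x ((j + 1 : ℕ) * (T / 2 ^ n)) - x (j * (T / 2 ^ n))) ^ 4)
      (fun _ _ => by positivity) (Finset.mem_range.mpr hj)
  have e : (7 / 8 : ℝ) ^ n * chainingTerm T x n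
      = (3 / 4) ^ n + (4 / 3) ^ n * dyadicSum T x n := by
    rw [chainingTerm, mul_add, ← mul_assoc, ← mul_pow, ← mul_pow]; norm_num
  rw [e]
  have h2 : (3 / 4 : ℝ) ^ n * (4 / 3) ^ n = 1 := by rw [← mul_pow]; norm_num
  have h3 : (0 : ℝ) < (3 / 4) ^ n := by positivity
  have h4 : (0 : ℝ) < (4 / 3) ^ n := by positivity
  have h5 : (4 / 3 : ℝ) ^ n * d ^ 4 ≤ (4 / 3) ^ n * dyadicSum T x n := by gcongr
  generalize (3 / 4 : ℝ) ^ n = p at *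
  generalize (4 / 3 : ℝ) ^ n = q at *
  have h6 : d ^ 2 ≤ p + q * d ^ 4 := by
    have : d ^ 2 * p ≤ (p + q * d ^ 4) * p := by
      have : (p + q * d ^ 4) * p = p ^ 2 + (p * q) * d ^ 4 := by ring
      rw [this, h2]
      nlinarith [sq_nonneg (p - d ^ 2), sq_nonneg d, sq_nonneg p]
    exact le_of_mul_le_mul_right this h3
  linarith

/-- A dyadic point of level `n + 1` either belongs to level `n` or lies one increment of level `n +
1` to the right of such a point, so it is reached from `0` by at most one increment per level. -/
theorem sq_dyadic_le (T : ℝ) {x : ℝ → ℝ} (hx : x 0 = 0) (n : ℕ) {j : ℕ} (hj : j ≤ 2 ^ n) :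
    x (j * (T / 2 ^ n)) ^ 2
      ≤ (∑ i ∈ Finset.range (n + 1), (7 / 8 : ℝ) ^ i)
        * ∑ i ∈ Finset.range (n + 1), chainingTerm T x i := by
  induction n generalizing j with
  | zero =>
    have h0 := chainingTerm_nonneg T x 0
    have h1 := sq_increment_le T x (n := 0) (j := 0) (by norm_num)
    have hj' : j = 0 ∨ j = 1 := by rw [pow_zero] at hj; omega
    rcases hj' with rfl | rfl
    · simp [hx, h0]
    · simpa [hx] using h1
  | succ n ih =>
    have hA : 0 < ∑ i ∈ Finset.range (n + 1), (7 / 8 : ℝ) ^ i :=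
      Finset.sum_pos (fun i _ => by positivity) (by simp)
    have hpow : (2 : ℕ) ^ (n + 1) = 2 * 2 ^ n := by ring
    have hstep : ∀ l : ℕ, ((2 * l : ℕ) : ℝ) * (T / 2 ^ (n + 1)) = l * (T / 2 ^ n) := by
      intro l; push_cast; rw [pow_succ]; field_simp
    rw [Finset.sum_range_succ _ (n + 1), Finset.sum_range_succ _ (n + 1)]
    rcases Nat.even_or_odd' j with ⟨l, rfl | rfl⟩
    · rw [hstep]
      have := sq_add_le_mul (d := 0) (y := chainingTerm T x (n + 1)) hA
        (by positivity : (0 : ℝ) < (7 / 8) ^ (n + 1)) (ih (j := l) (by omega))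
        (by
          have := chainingTerm_nonneg T x (n + 1)
          rw [zero_pow two_ne_zero]
          exact mul_nonneg (by positivity) this)
      simpa using this
    · have := sq_add_le_mul hA
        (by positivity : (0 : ℝ) < (7 / 8) ^ (n + 1)) (ih (j := l) (by omega))
        (sq_increment_le T x (n := n + 1) (j := 2 * l) (by omega))
      rw [hstep] at this
      simpa using this

/-- The chaining bound of the supremum of the square of a path on `[0, T]`. -/
noncomputable def chainingBound (T : ℝ) (x : ℝ → ℝ) : ℝ≥0∞ :=
  8 * ∑' i, ENNReal.ofReal (chainingTerm T x i)

theorem sum_pow_seven_eighths_le (n : ℕ) : ∑ i ∈ Finset.range n, (7 / 8 : ℝ) ^ i ≤ 8 := by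
  have := geom_sum_eq (x := (7 / 8 : ℝ)) (by norm_num) n
  rw [this, div_le_iff_of_neg (by norm_num)]
  have : (0 : ℝ) ≤ (7 / 8) ^ n := by positivity
  linarith

/-- The bound holds at dyadic points with a constant free of the level, since the weights `(7/8)^i`
sum to at most `8`; continuity extends it to all of `[0, T]`. -/
theorem ofReal_sq_le_chainingBound {T : ℝ} (hT : 0 < T) {x : ℝ → ℝ} (hx : x 0 = 0)
    (hc : Continuous x) {t : ℝ} (ht : t ∈ Icc 0 T) :
    ENNReal.ofReal (x t ^ 2) ≤ chainingBound T x := by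
  have hdy : ∀ n j : ℕ, j ≤ 2 ^ n →
      ENNReal.ofReal (x (j * (T / 2 ^ n)) ^ 2) ≤ chainingBound T x := by
    intro n j hj
    have h0 : 0 ≤ ∑ i ∈ Finset.range (n + 1), chainingTerm T x i :=
      Finset.sum_nonneg fun i _ => chainingTerm_nonneg T x i
    calc _ ≤ ENNReal.ofReal (8 * ∑ i ∈ Finset.range (n + 1), chainingTerm T x i) := by
          refine ENNReal.ofReal_le_ofReal ((sq_dyadic_le T hx n hj).trans ?_)
          gcongr
          exact sum_pow_seven_eighths_le _
      _ = 8 * ∑ i ∈ Finset.range (n + 1), ENNReal.ofReal (chainingTerm T x i) := by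
          rw [ENNReal.ofReal_mul (by norm_num),
            ENNReal.ofReal_sum_of_nonneg fun i _ => chainingTerm_nonneg T x i]
          norm_num
      _ ≤ _ := by
          unfold chainingBound
          gcongr
          exact ENNReal.sum_le_tsum _
  have hlim : Filter.Tendsto (fun n : ℕ => (⌊t / T * 2 ^ n⌋₊ : ℝ) * (T / 2 ^ n)) Filter.atTop
      (nhds t) := by
    have h1 : Filter.Tendsto (fun n : ℕ => (⌊t / T * 2 ^ n⌋₊ : ℝ) / (2 : ℝ) ^ n) Filter.atTop
        (nhds (t / T)) :=
      (tendsto_nat_floor_mul_div_atTop (div_nonneg ht.1 hT.le)).comp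
        (tendsto_pow_atTop_atTop_of_one_lt (by norm_num : (1 : ℝ) < 2))
    have h2 := h1.mul_const T
    rw [div_mul_cancel₀ _ hT.ne'] at h2
    refine h2.congr fun n => ?_
    ring
  refine le_of_tendsto' (ENNReal.tendsto_ofReal (((hc.tendsto t).comp hlim).pow 2)) fun n =>
    hdy n _ ?_
  have : t / T * 2 ^ n ≤ ((2 ^ n : ℕ) : ℝ) := by
    push_cast
    exact mul_le_of_le_one_left (by positivity) ((div_le_one hT).mpr ht.2)
  exact Nat.floor_le_of_le this

variable {Ω : Type*} {m : MeasurableSpace Ω} {P : Measure Ω}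

theorem measurable_chainingBound {X : ℝ → Ω → ℝ} (hX : ∀ t, Measurable (X t)) (T : ℝ) :
    Measurable fun ω => chainingBound T fun t => X t ω := by
  unfold chainingBound chainingTerm dyadicSum
  fun_prop

/-- A bound of the expectation of `chainingBound`. -/
noncomputable def chainingConst (C : ℝ) : ℝ≥0∞ :=
  8 * ∑' i : ℕ, ENNReal.ofReal ((6 / 7) ^ i + (16 / 21) ^ i * C)

theorem chainingConst_ne_top {C : ℝ} (hC : 0 ≤ C) : chainingConst C ≠ ∞ := by
  refine ENNReal.mul_ne_top (by norm_num) ?_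
  have h : Summable fun i : ℕ => (6 / 7 : ℝ) ^ i + (16 / 21) ^ i * C :=
    (summable_geometric_of_lt_one (by norm_num) (by norm_num)).add
      ((summable_geometric_of_lt_one (by norm_num) (by norm_num)).mul_right C)
  rw [← ENNReal.ofReal_tsum_of_nonneg (fun i => by positivity) h]
  exact ENNReal.ofReal_ne_top

/-- Level `n` has `2ⁿ` increments, each with fourth moment at most `C (T/2ⁿ)²`, so its dyadic sum
has mean at most `2⁻ⁿ C T²`. -/
theorem lintegral_chainingBound_le [IsProbabilityMeasure P] {X : ℝ → Ω → ℝ}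
    (hX : ∀ t, Measurable (X t)) {T C : ℝ}
    (hT : 0 < T) (hC : 0 ≤ C)
    (h : ∀ s t, 0 ≤ s → s < t → t ≤ T →
      ∫⁻ ω, ENNReal.ofReal ((X t ω - X s ω) ^ 4) ∂P ≤ ENNReal.ofReal (C * (t - s) ^ 2)) :
    ∫⁻ ω, chainingBound T (fun t => X t ω) ∂P ≤ chainingConst (C * T ^ 2) := by
  have hD : ∀ n, Measurable fun ω => dyadicSum T (fun t => X t ω) n := by
    intro n; unfold dyadicSum; fun_prop
  have hDi : ∀ n, ∫⁻ ω, ENNReal.ofReal (dyadicSum T (fun t => X t ω) n) ∂P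
      ≤ ENNReal.ofReal ((1 / 2) ^ n * (C * T ^ 2)) := by
    intro n
    have e : ∀ ω, ENNReal.ofReal (dyadicSum T (fun t => X t ω) n)
        = ∑ j ∈ Finset.range (2 ^ n), ENNReal.ofReal
          ((X ((j + 1 : ℕ) * (T / 2 ^ n)) ω - X (j * (T / 2 ^ n)) ω) ^ 4) := fun ω =>
      ENNReal.ofReal_sum_of_nonneg fun _ _ => by positivity
    simp only [e]
    rw [lintegral_finsetSum _ fun j _ => by fun_prop]
    calc _ ≤ ∑ j ∈ Finset.range (2 ^ n), ENNReal.ofReal (C * (T / 2 ^ n) ^ 2) := by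
          refine Finset.sum_le_sum fun j hj => ?_
          rw [Finset.mem_range] at hj
          have hp : 0 < T / 2 ^ n := by positivity
          have := h (j * (T / 2 ^ n)) ((j + 1 : ℕ) * (T / 2 ^ n)) (by positivity)
            (by push_cast; linarith) ?_
          · refine this.trans_eq ?_
            congr 2
            push_cast; ring
          · have h1 : ((j + 1 : ℕ) : ℝ) ≤ 2 ^ n := by exact_mod_cast hj
            calc _ ≤ 2 ^ n * (T / 2 ^ n) := by gcongr
              _ = T := by field_simp
      _ = _ := by
          rw [Finset.sum_const, Finset.card_range, nsmul_eq_mul, ← ENNReal.ofReal_natCast,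
            ← ENNReal.ofReal_mul (by positivity)]
          congr 1
          push_cast
          rw [one_div, inv_pow]
          field_simp
  have hterm : ∀ n, Measurable fun ω => chainingTerm T (fun t => X t ω) n := fun n =>
    ((hD n).const_mul _).const_add _
  unfold chainingBound chainingConst
  rw [lintegral_const_mul' _ _ (by norm_num),
    lintegral_tsum fun i => (hterm i).ennreal_ofReal.aemeasurable]
  gcongr with i
  simp only [chainingTerm]
  have e : ∀ ω, ENNReal.ofReal ((6 / 7) ^ i + (32 / 21) ^ i * dyadicSum T (fun t => X t ω) i)
      = ENNReal.ofReal ((6 / 7) ^ i)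
        + ENNReal.ofReal ((32 / 21) ^ i) * ENNReal.ofReal (dyadicSum T (fun t => X t ω) i) := by
    intro ω
    have := dyadicSum_nonneg T (fun t => X t ω) i
    rw [ENNReal.ofReal_add (by positivity) (by positivity), ENNReal.ofReal_mul (by positivity)]
  simp only [e]
  rw [lintegral_add_left measurable_const, lintegral_const, measure_univ, mul_one,
    lintegral_const_mul' _ _ ENNReal.ofReal_ne_top, ENNReal.ofReal_add (by positivity)
    (by positivity)]
  gcongr
  refine (mul_le_mul_right (hDi i) _).trans_eq ?_
  rw [← ENNReal.ofReal_mul (by positivity), ← mul_assoc, ← mul_pow]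
  norm_num

end StochWave

namespace StochWave

/-! ### The damped oscillator driven by a continuous path -/

theorem continuous_pathIntegral {φ φ' w : ℝ → ℝ} (hφ : ∀ t, HasDerivAt φ (φ' t) t)
    (hφ' : Continuous φ') (hw : Continuous w) : Continuous (pathIntegral φ φ' w) := by
  have hc : Continuous φ := continuous_iff_continuousAt.mpr fun t => (hφ t).continuousAt
  exact (hc.mul hw).sub (intervalIntegral.continuous_primitive
    (fun a b => (hφ'.mul hw).intervalIntegrable a b) 0)

theorem pathIntegral_zero (φ φ' : ℝ → ℝ) {w : ℝ → ℝ} (hw : w 0 = 0) :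
    pathIntegral φ φ' w 0 = 0 := by
  simp [pathIntegral, hw]

/-- The function `e^{bt} cos(κt)`. -/
noncomputable def expCos (b κ t : ℝ) : ℝ := Real.exp (b * t) * Real.cos (κ * t)

/-- The function `e^{bt} sin(κt)`. -/
noncomputable def expSin (b κ t : ℝ) : ℝ := Real.exp (b * t) * Real.sin (κ * t)

/-- The derivative of `expCos`. -/
noncomputable def expCosDeriv (b κ t : ℝ) : ℝ :=
  Real.exp (b * t) * (b * Real.cos (κ * t) - κ * Real.sin (κ * t))

/-- The derivative of `expSin`. -/
noncomputable def expSinDeriv (b κ t : ℝ) : ℝ :=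
  Real.exp (b * t) * (b * Real.sin (κ * t) + κ * Real.cos (κ * t))

theorem hasDerivAt_exp_mul (b t : ℝ) :
    HasDerivAt (fun t => Real.exp (b * t)) (b * Real.exp (b * t)) t := by
  simpa [mul_comm] using ((hasDerivAt_id t).const_mul b).exp

theorem hasDerivAt_cos_mul (κ t : ℝ) :
    HasDerivAt (fun t => Real.cos (κ * t)) (-(κ * Real.sin (κ * t))) t := by
  simpa [mul_comm] using ((hasDerivAt_id t).const_mul κ).cos

theorem hasDerivAt_sin_mul (κ t : ℝ) :
    HasDerivAt (fun t => Real.sin (κ * t)) (κ * Real.cos (κ * t)) t := by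
  simpa [mul_comm] using ((hasDerivAt_id t).const_mul κ).sin

theorem hasDerivAt_expCos (b κ t : ℝ) : HasDerivAt (expCos b κ) (expCosDeriv b κ t) t := by
  refine ((hasDerivAt_exp_mul b t).mul (hasDerivAt_cos_mul κ t)).congr_deriv ?_
  simp only [expCosDeriv]; ring

theorem hasDerivAt_expSin (b κ t : ℝ) : HasDerivAt (expSin b κ) (expSinDeriv b κ t) t := by
  refine ((hasDerivAt_exp_mul b t).mul (hasDerivAt_sin_mul κ t)).congr_deriv ?_
  simp only [expSinDeriv]; ring

theorem continuous_expCosDeriv (b κ : ℝ) : Continuous (expCosDeriv b κ) := by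
  unfold expCosDeriv; fun_prop

theorem continuous_expSinDeriv (b κ : ℝ) : Continuous (expSinDeriv b κ) := by
  unfold expSinDeriv; fun_prop

/-- The integral `∫_0^t e^{bs} cos(κs) dw(s)`. -/
noncomputable def cosIntegral (b κ : ℝ) : (ℝ → ℝ) → ℝ → ℝ :=
  pathIntegral (expCos b κ) (expCosDeriv b κ)

/-- The integral `∫_0^t e^{bs} sin(κs) dw(s)`. -/
noncomputable def sinIntegral (b κ : ℝ) : (ℝ → ℝ) → ℝ → ℝ :=
  pathIntegral (expSin b κ) (expSinDeriv b κ)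

/-- The position `u(t) = κ⁻¹ ∫_0^t e^{-b(t-s)} sin(κ(t-s)) dw(s)` of the oscillator
`u'' = -(b² + κ²) u - 2b u' + w'`. -/
noncomputable def oscPosition (b κ : ℝ) (w : ℝ → ℝ) (t : ℝ) : ℝ :=
  Real.exp (-b * t) / κ
    * (Real.sin (κ * t) * cosIntegral b κ w t - Real.cos (κ * t) * sinIntegral b κ w t)

/-- The velocity of the oscillator. -/
noncomputable def oscVelocity (b κ : ℝ) (w : ℝ → ℝ) (t : ℝ) : ℝ :=
  Real.exp (-b * t)
    * ((Real.cos (κ * t) * cosIntegral b κ w t + Real.sin (κ * t) * sinIntegral b κ w t)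
      - b / κ * (Real.sin (κ * t) * cosIntegral b κ w t - Real.cos (κ * t) * sinIntegral b κ w t))

theorem exp_mul_exp_neg (b t : ℝ) : Real.exp (b * t) * Real.exp (-b * t) = 1 := by
  rw [← Real.exp_add]; simp

/-- The boundary terms of the two integrations by parts cancel, so the position involves `w` only
under integrals and is differentiable although `w` is not. -/
theorem oscPosition_eq (b κ : ℝ) (w : ℝ → ℝ) :
    oscPosition b κ w = fun t => Real.exp (-b * t) * (Real.cos (κ * t)
        * (∫ r in (0 : ℝ)..t, expSinDeriv b κ r * w r)
      - Real.sin (κ * t) * ∫ r in (0 : ℝ)..t, expCosDeriv b κ r * w r) / κ := by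
  ext t
  simp only [oscPosition, cosIntegral, sinIntegral, pathIntegral, expCos, expSin]
  ring

/-- Here the boundary terms add up to exactly `w t`, because `cos² + sin² = 1`; the velocity minus
the noise is therefore differentiable. -/
theorem oscVelocity_eq (b κ : ℝ) (w : ℝ → ℝ) :
    oscVelocity b κ w = fun t => Real.exp (-b * t) * ((b / κ * Real.sin (κ * t) - Real.cos (κ * t))
        * (∫ r in (0 : ℝ)..t, expCosDeriv b κ r * w r)
      - (b / κ * Real.cos (κ * t) + Real.sin (κ * t))
        * ∫ r in (0 : ℝ)..t, expSinDeriv b κ r * w r) + w t := by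
  ext t
  simp only [oscVelocity, cosIntegral, sinIntegral, pathIntegral, expCos, expSin]
  have h := exp_mul_exp_neg b t
  have h2 := Real.sin_sq_add_cos_sq (κ * t)
  linear_combination (Real.sin (κ * t) ^ 2 + Real.cos (κ * t) ^ 2) * w t * h + w t * h2

section

variable {b κ : ℝ} {w : ℝ → ℝ}

theorem hasDerivAt_oscPosition (hκ : κ ≠ 0) (hw : Continuous w) (t : ℝ) :
    HasDerivAt (oscPosition b κ w) (oscVelocity b κ w t) t := by
  have h := exp_mul_exp_neg b t
  have h2 := Real.sin_sq_add_cos_sq (κ * t)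
  have dc := ((continuous_expCosDeriv b κ).mul hw).integral_hasStrictDerivAt 0 t |>.hasDerivAt
  have ds := ((continuous_expSinDeriv b κ).mul hw).integral_hasStrictDerivAt 0 t |>.hasDerivAt
  rw [oscPosition_eq, oscVelocity_eq]
  refine (((hasDerivAt_exp_mul (-b) t).mul (((hasDerivAt_cos_mul κ t).mul ds).sub
    ((hasDerivAt_sin_mul κ t).mul dc))).div_const κ).congr_deriv ?_
  simp only [Pi.mul_apply, Pi.sub_apply]
  set Ic := ∫ r in (0 : ℝ)..t, expCosDeriv b κ r * w r
  set Is := ∫ r in (0 : ℝ)..t, expSinDeriv b κ r * w r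
  simp only [expCosDeriv, expSinDeriv]
  generalize Real.exp (b * t) = E at *
  generalize Real.exp (-b * t) = F at *
  generalize Real.sin (κ * t) = x at *
  generalize Real.cos (κ * t) = y at *
  field_simp
  linear_combination κ * (x ^ 2 + y ^ 2) * w t * h
    + κ * w t * h2

theorem hasDerivAt_oscVelocity_sub (hκ : κ ≠ 0) (hw : Continuous w) (t : ℝ) :
    HasDerivAt (fun t => oscVelocity b κ w t - w t)
      (-(b ^ 2 + κ ^ 2) * oscPosition b κ w t - 2 * b * oscVelocity b κ w t) t := by
  have h := exp_mul_exp_neg b t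
  have h2 := Real.sin_sq_add_cos_sq (κ * t)
  have dc := ((continuous_expCosDeriv b κ).mul hw).integral_hasStrictDerivAt 0 t |>.hasDerivAt
  have ds := ((continuous_expSinDeriv b κ).mul hw).integral_hasStrictDerivAt 0 t |>.hasDerivAt
  rw [oscPosition_eq, oscVelocity_eq]
  simp only [add_sub_cancel_right]
  refine ((hasDerivAt_exp_mul (-b) t).mul
    (((((hasDerivAt_sin_mul κ t).const_mul (b / κ)).sub (hasDerivAt_cos_mul κ t)).mul dc).sub
      ((((hasDerivAt_cos_mul κ t).const_mul (b / κ)).add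
        (hasDerivAt_sin_mul κ t)).mul ds))).congr_deriv ?_
  simp only [Pi.mul_apply, Pi.sub_apply, Pi.add_apply]
  set Ic := ∫ r in (0 : ℝ)..t, expCosDeriv b κ r * w r
  set Is := ∫ r in (0 : ℝ)..t, expSinDeriv b κ r * w r
  simp only [expCosDeriv, expSinDeriv]
  generalize Real.exp (b * t) = E at *
  generalize Real.exp (-b * t) = F at *
  generalize Real.sin (κ * t) = x at *
  generalize Real.cos (κ * t) = y at *
  field_simp
  linear_combination -2 * κ * b * (x ^ 2 + y ^ 2) * w t * h
    - 2 * κ * b * w t * h2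

theorem continuous_oscPosition (hκ : κ ≠ 0) (hw : Continuous w) :
    Continuous (oscPosition b κ w) :=
  continuous_iff_continuousAt.mpr fun t => (hasDerivAt_oscPosition hκ hw t).continuousAt

theorem continuous_oscVelocity (hκ : κ ≠ 0) (hw : Continuous w) :
    Continuous (oscVelocity b κ w) := by
  have h : Continuous fun t => oscVelocity b κ w t - w t :=
    continuous_iff_continuousAt.mpr fun t => (hasDerivAt_oscVelocity_sub hκ hw t).continuousAt
  exact (h.add hw).congr fun t => by simp

theorem oscPosition_eq_integral (hκ : κ ≠ 0) (hw : Continuous w) (hw0 : w 0 = 0) (t : ℝ) :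
    oscPosition b κ w t = ∫ s in (0 : ℝ)..t, oscVelocity b κ w s := by
  rw [intervalIntegral.integral_eq_sub_of_hasDerivAt
    (fun x _ => hasDerivAt_oscPosition hκ hw x)
    ((continuous_oscVelocity hκ hw).intervalIntegrable _ _)]
  simp [oscPosition, cosIntegral, sinIntegral, pathIntegral_zero _ _ hw0]

theorem oscVelocity_eq_integral (hκ : κ ≠ 0) (hw : Continuous w) (hw0 : w 0 = 0) (t : ℝ) :
    oscVelocity b κ w t
      = (∫ s in (0 : ℝ)..t,
          (-(b ^ 2 + κ ^ 2) * oscPosition b κ w s - 2 * b * oscVelocity b κ w s)) + w t := by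
  have := continuous_oscPosition (b := b) hκ hw
  have := continuous_oscVelocity (b := b) hκ hw
  rw [intervalIntegral.integral_eq_sub_of_hasDerivAt
    (fun x _ => hasDerivAt_oscVelocity_sub hκ hw x)
    ((by fun_prop : Continuous _).intervalIntegrable _ _)]
  simp [oscVelocity, cosIntegral, sinIntegral, pathIntegral_zero _ _ hw0, hw0]

/-! ### Bounds of the oscillator by the cosine and sine integrals -/

theorem exp_mul_le {c T t : ℝ} (hc : |c| ≤ 1) (ht : t ∈ Icc 0 T) :
    Real.exp (c * t) ≤ Real.exp T := by
  rw [Real.exp_le_exp]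
  have := (abs_le.mp hc).2
  nlinarith [ht.1, ht.2]

theorem abs_expCos_le {T t : ℝ} (hb : |b| ≤ 1) (ht : t ∈ Icc 0 T) :
    |expCos b κ t| ≤ Real.exp T := by
  rw [expCos, abs_mul, abs_of_pos (Real.exp_pos _)]
  exact (mul_le_of_le_one_right (Real.exp_pos _).le (Real.abs_cos_le_one _)).trans
    (exp_mul_le hb ht)

theorem abs_expSin_le {T t : ℝ} (hb : |b| ≤ 1) (ht : t ∈ Icc 0 T) :
    |expSin b κ t| ≤ Real.exp T := by
  rw [expSin, abs_mul, abs_of_pos (Real.exp_pos _)]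
  exact (mul_le_of_le_one_right (Real.exp_pos _).le (Real.abs_sin_le_one _)).trans
    (exp_mul_le hb ht)

theorem sq_oscPosition_le {T t : ℝ} (hb : |b| ≤ 1) (ht : t ∈ Icc 0 T) :
    oscPosition b κ w t ^ 2
      ≤ Real.exp T ^ 2 / κ ^ 2 * (cosIntegral b κ w t ^ 2 + sinIntegral b κ w t ^ 2) := by
  rw [oscPosition, mul_pow, div_pow]
  have h2 := Real.sin_sq_add_cos_sq (κ * t)
  have h3 := exp_mul_le (c := -b) (by rwa [abs_neg]) ht
  gcongr
  nlinarith [sq_nonneg (Real.cos (κ * t) * cosIntegral b κ w t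
    + Real.sin (κ * t) * sinIntegral b κ w t)]

theorem sq_oscVelocity_le {T t : ℝ} (hb : |b| ≤ 1) (hbκ : |b / κ| ≤ 1) (ht : t ∈ Icc 0 T) :
    oscVelocity b κ w t ^ 2
      ≤ 4 * Real.exp T ^ 2 * (cosIntegral b κ w t ^ 2 + sinIntegral b κ w t ^ 2) := by
  rw [oscVelocity, mul_pow]
  have h2 := Real.sin_sq_add_cos_sq (κ * t)
  have h3 := exp_mul_le (c := -b) (by rwa [abs_neg]) ht
  have h4 : (b / κ) ^ 2 ≤ 1 := (sq_le_one_iff_abs_le_one _).mpr hbκ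
  rw [mul_comm 4, mul_assoc]
  gcongr
  set A := cosIntegral b κ w t
  set B := sinIntegral b κ w t
  -- The pair `(p, q)` is `(A, B)` up to an orthogonal map, so `A² + B² = p² + q²`.
  set p := Real.cos (κ * t) * A + Real.sin (κ * t) * B with hp
  set q := Real.sin (κ * t) * A - Real.cos (κ * t) * B with hq
  have e : A ^ 2 + B ^ 2 = p ^ 2 + q ^ 2 := by
    rw [hp, hq]; linear_combination -(A ^ 2 + B ^ 2) * h2
  rw [e]
  nlinarith [sq_nonneg (p + b / κ * q), mul_le_mul_of_nonneg_right h4 (sq_nonneg q),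
    sq_nonneg p, sq_nonneg q]

end

/-! ### Uniqueness for the homogeneous oscillator -/

/-- The projection of the real line onto `[0, T]`. -/
noncomputable def clamp (T t : ℝ) : ℝ := max 0 (min t T)

theorem continuous_clamp (T : ℝ) : Continuous (clamp T) := by
  unfold clamp; fun_prop

theorem clamp_mem {T : ℝ} (hT : 0 ≤ T) (t : ℝ) : clamp T t ∈ Icc 0 T :=
  ⟨le_max_left _ _, max_le hT (min_le_right _ _)⟩

theorem clamp_of_mem {T t : ℝ} (ht : t ∈ Icc 0 T) : clamp T t = t := by
  rw [clamp, min_eq_left ht.2, max_eq_right ht.1]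

/-- Integrability suffices: the integral equations themselves make `p` and `q` continuous, and then
differentiable, so uniqueness for linear ODEs applies. Composing with `clamp` gives continuous
extensions to the line, whose primitives are differentiable everywhere. -/
theorem eq_zero_of_homogeneous {p q : ℝ → ℝ} {T c d : ℝ} (hT : 0 ≤ T)
    (hp : IntervalIntegrable p volume 0 T) (hq : IntervalIntegrable q volume 0 T)
    (h1 : ∀ t ∈ Icc 0 T, p t = ∫ s in (0 : ℝ)..t, q s)
    (h2 : ∀ t ∈ Icc 0 T, q t = ∫ s in (0 : ℝ)..t, (c * p s + d * q s)) :
    ∀ t ∈ Icc 0 T, p t = 0 ∧ q t = 0 := by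
  have hu : uIcc 0 T = Icc 0 T := uIcc_of_le hT
  have hsub : ∀ t ∈ Icc 0 T, uIcc 0 t ⊆ Icc 0 T := fun t ht => by
    rw [uIcc_of_le ht.1]; exact Icc_subset_Icc_right ht.2
  have cp : ContinuousOn p (Icc 0 T) := by
    have := intervalIntegral.continuousOn_primitive_interval' hq left_mem_uIcc
    rw [hu] at this
    exact this.congr h1
  have cq : ContinuousOn q (Icc 0 T) := by
    have := intervalIntegral.continuousOn_primitive_interval'
      ((hp.const_mul c).add (hq.const_mul d)) left_mem_uIcc
    rw [hu] at this
    exact this.congr h2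
  set p' : ℝ → ℝ := fun t => p (clamp T t) with hp'
  set q' : ℝ → ℝ := fun t => q (clamp T t) with hq'
  have cp' : Continuous p' := cp.comp_continuous (continuous_clamp T) (clamp_mem hT)
  have cq' : Continuous q' := cq.comp_continuous (continuous_clamp T) (clamp_mem hT)
  have ep : ∀ t ∈ Icc 0 T, p' t = p t := fun t ht => by simp only [hp', clamp_of_mem ht]
  have eq : ∀ t ∈ Icc 0 T, q' t = q t := fun t ht => by simp only [hq', clamp_of_mem ht]
  set f : ℝ → ℝ × ℝ := fun t =>
    (∫ s in (0 : ℝ)..t, q' s, ∫ s in (0 : ℝ)..t, (c * p' s + d * q' s)) with hf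
  have ef : ∀ t ∈ Icc 0 T, f t = (p t, q t) := by
    intro t ht
    rw [hf, h1 t ht, h2 t ht]
    refine Prod.ext (intervalIntegral.integral_congr fun s hs => eq s (hsub t ht hs))
      (intervalIntegral.integral_congr fun s hs => ?_)
    simp only [ep s (hsub t ht hs), eq s (hsub t ht hs)]
  have c2 : Continuous fun s => c * p' s + d * q' s := by fun_prop
  have df : ∀ t, HasDerivAt f (q' t, c * p' t + d * q' t) t := fun t =>
    (cq'.integral_hasStrictDerivAt 0 t).hasDerivAt.prodMk
      (c2.integral_hasStrictDerivAt 0 t).hasDerivAt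
  let L : ℝ × ℝ →L[ℝ] ℝ × ℝ := (ContinuousLinearMap.snd ℝ ℝ ℝ).prod
    (c • ContinuousLinearMap.fst ℝ ℝ ℝ + d • ContinuousLinearMap.snd ℝ ℝ ℝ)
  have hL : ∀ z, L z = (z.2, c * z.1 + d * z.2) := fun z => rfl
  have key := ODE_solution_unique (v := fun _ => L) (f := f) (g := fun _ => 0) (a := 0) (b := T)
    (fun _ => L.lipschitz)
    (continuous_iff_continuousAt.mpr fun t => (df t).continuousAt).continuousOn
    (fun t ht => by
      have ht' := Ico_subset_Icc_self ht
      rw [ef t ht', hL, ← ep t ht', ← eq t ht']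
      exact (df t).hasDerivWithinAt)
    continuousOn_const
    (fun t _ => by simpa using hasDerivWithinAt_const t (Ici t) (0 : ℝ × ℝ))
    (by simp [hf])
  intro t ht
  have := key ht
  rw [ef t ht] at this
  exact Prod.mk_eq_zero.mp this

end StochWave

namespace StochWave

/-! ### Coefficients of weak solutions and uniqueness -/

theorem duality_sine (c : ℕ+ → ℝ) (k : ℕ+) : duality c (sine k) = c k := by
  rw [duality, tsum_eq_single k]
  · simp [sineCoeff_sine]
  · intro j hj
    simp [sineCoeff_sine, hj.symm]

theorem integral_mul_secondDeriv_sine (g : L2pi) (k : ℕ+) :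
    ∫ x in Ioo (0 : ℝ) Real.pi, g x * secondDeriv (sine k) x
      = -((k : ℝ) ^ 2 * sineCoeff g k) := by
  have h := hasSum_sineCoeff_mul_of_memLp g
    (memLp_of_continuousOn (isTestFunction_sine k).continuousOn_secondDeriv)
  rw [← h.tsum_eq, tsum_eq_single k]
  · rw [(isTestFunction_sine k).sineCoeff_secondDeriv, sineCoeff_sine]
    simp; ring
  · intro j hj
    simp [(isTestFunction_sine k).sineCoeff_secondDeriv, sineCoeff_sine, hj.symm]

variable {Ω : Type*} {m : MeasurableSpace Ω} {P : Measure Ω}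

/-- A single term of the Sobolev series is dominated by the whole norm. With Fubini this makes
almost every path of a coefficient integrable, as the ODE argument requires. -/
theorem MemL2Sobolev.integrable_coeff [IsFiniteMeasure P] {T γ : ℝ} {c : ℝ → Ω → ℕ+ → ℝ}
    (hc : MemL2Sobolev P T γ c) (k : ℕ+) :
    Integrable (fun p : Ω × ℝ => c p.2 p.1 k) (timeMeasure P T) := by
  have hk : (0 : ℝ) < (k : ℝ) ^ (2 * γ) := Real.rpow_pos_of_pos (by exact_mod_cast k.pos) _
  have hfin : IsFiniteMeasure (timeMeasure P T) := by
    unfold timeMeasure; infer_instance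
  have hsq : Integrable (fun p : Ω × ℝ => (k : ℝ) ^ (2 * γ) * c p.2 p.1 k ^ 2)
      (timeMeasure P T) := by
    refine ⟨(((hc.1 k).pow_const 2).const_mul _).aestronglyMeasurable, ?_⟩
    rw [hasFiniteIntegral_iff_ofReal (Filter.Eventually.of_forall fun p => by positivity)]
    refine lt_of_le_of_lt (lintegral_mono fun p => ?_) hc.2
    exact ENNReal.le_tsum k
  have : MemLp (fun p : Ω × ℝ => c p.2 p.1 k) 2 (timeMeasure P T) := by
    rw [memLp_two_iff_integrable_sq (hc.1 k).aestronglyMeasurable]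
    refine (hsq.const_mul ((k : ℝ) ^ (2 * γ))⁻¹).congr (Filter.Eventually.of_forall fun p => ?_)
    simp only
    field_simp
  exact this.integrable (by norm_num)

theorem ae_intervalIntegrable [SFinite P] {T : ℝ} (hT : 0 ≤ T) {f : Ω × ℝ → ℝ}
    (hf : Integrable f (timeMeasure P T)) :
    ∀ᵐ ω ∂P, IntervalIntegrable (fun t => f (ω, t)) volume 0 T := by
  filter_upwards [hf.prod_right_ae] with ω hω
  rwa [intervalIntegrable_iff_integrableOn_Ioo_of_le hT]

namespace IsWeakSolution

variable {𝓕 : Filtration ℝ≥0 m} {W : L2pi → ℝ≥0 → Ω → ℝ} {a b T : ℝ}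
  {u u' : ℝ → Ω → L2pi} {v v' : ℝ → Ω → SobolevSpace (-1)}

theorem ae_coeff [IsFiniteMeasure P] (h : IsWeakSolution P 𝓕 W a b T u v) (hT : 0 ≤ T) :
    ∀ᵐ ω ∂P, ∀ k, IntervalIntegrable (fun t => sineCoeff (u t ω) k) volume 0 T ∧
      IntervalIntegrable (fun t => (v t ω).coeff k) volume 0 T ∧ ∀ t ∈ Icc 0 T,
        sineCoeff (u t ω) k = ∫ s in (0 : ℝ)..t, (v s ω).coeff k ∧
        (v t ω).coeff k = (∫ s in (0 : ℝ)..t,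
          (-(a ^ 2 * (k : ℝ) ^ 2) * sineCoeff (u s ω) k + -(2 * b) * (v s ω).coeff k))
            + W (sineL2 k) t.toNNReal ω := by
  have hfin : IsFiniteMeasure (timeMeasure P T) := by
    unfold timeMeasure; infer_instance
  rw [ae_all_iff]
  intro k
  have hu : Integrable (fun p : Ω × ℝ => sineCoeff (u p.2 p.1) k) (timeMeasure P T) := by
    simp only [← inner_sineL2]
    exact (h.memL2_u.integrable (by norm_num)).const_inner (sineL2 k)
  filter_upwards [ae_intervalIntegrable hT hu,
    ae_intervalIntegrable hT (h.memL2_v.integrable_coeff k),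
    h.equations (sine k) (isTestFunction_sine k)] with ω h1 h2 h3
  refine ⟨h1, h2, fun t ht => ?_⟩
  have := h3 t.toNNReal (by rw [Real.coe_toNNReal t ht.1]; exact ht.2)
  simp only [duality_sine, integral_mul_sine, integral_mul_secondDeriv_sine,
    Real.coe_toNNReal t ht.1] at this
  refine ⟨this.1, ?_⟩
  rw [this.2]
  congr 1
  refine intervalIntegral.integral_congr fun s _ => ?_
  ring

theorem ae_eq [IsFiniteMeasure P] (h : IsWeakSolution P 𝓕 W a b T u v)
    (h' : IsWeakSolution P 𝓕 W a b T u' v') (hT : 0 ≤ T) :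
    ∀ᵐ ω ∂P, ∀ t ∈ Icc 0 T, u' t ω = u t ω ∧ v' t ω = v t ω := by
  filter_upwards [h.ae_coeff hT, h'.ae_coeff hT] with ω h1 h2
  have key : ∀ k, ∀ t ∈ Icc 0 T, sineCoeff (u' t ω) k - sineCoeff (u t ω) k = 0 ∧
      (v' t ω).coeff k - (v t ω).coeff k = 0 := by
    intro k
    obtain ⟨i1, j1, e1⟩ := h1 k
    obtain ⟨i2, j2, e2⟩ := h2 k
    have hsub : ∀ t ∈ Icc 0 T, uIcc 0 t ⊆ uIcc 0 T := fun t ht => by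
      rw [uIcc_of_le ht.1, uIcc_of_le hT]; exact Icc_subset_Icc_right ht.2
    refine eq_zero_of_homogeneous (c := -(a ^ 2 * (k : ℝ) ^ 2)) (d := -(2 * b)) hT
      (i2.sub i1) (j2.sub j1) (fun t ht => ?_) (fun t ht => ?_)
    · rw [(e1 t ht).1, (e2 t ht).1, intervalIntegral.integral_sub (j2.mono_set (hsub t ht))
        (j1.mono_set (hsub t ht))]
    · rw [(e1 t ht).2, (e2 t ht).2, add_sub_add_right_eq_sub, ← intervalIntegral.integral_sub]
      · refine intervalIntegral.integral_congr fun s _ => ?_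
        ring
      · exact ((i2.const_mul _).add (j2.const_mul _)).mono_set (hsub t ht)
      · exact ((i1.const_mul _).add (j1.const_mul _)).mono_set (hsub t ht)
  intro t ht
  refine ⟨ext_sineCoeff fun k => sub_eq_zero.mp (key k t ht).1, Subtype.ext ?_⟩
  ext k
  exact sub_eq_zero.mp (key k t ht).2

end IsWeakSolution

end StochWave

namespace StochWave

/-! ### The modes of the solution -/

section Frequency

/-- The frequency `√(a² k² - b²)` of the `k`-th mode. -/
noncomputable def freq (a b : ℝ) (k : ℕ+) : ℝ := Real.sqrt (a ^ 2 * (k : ℝ) ^ 2 - b ^ 2)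

variable {a b : ℝ}

theorem one_le_coe (k : ℕ+) : (1 : ℝ) ≤ k := by exact_mod_cast k.pos

/-- The parameter restrictions enter here: they exclude overdamped modes and make the frequency grow
linearly in `k`. -/
theorem sq_div_four_le (ha : 1 ≤ a) (hb : 2 * |b| ≤ 1) (k : ℕ+) :
    (k : ℝ) ^ 2 / 4 ≤ a ^ 2 * (k : ℝ) ^ 2 - b ^ 2 := by
  have h1 := one_le_coe k
  have h2 : b ^ 2 ≤ 1 / 4 := by rw [← sq_abs]; nlinarith [abs_nonneg b]
  have h3 : (k : ℝ) ^ 2 ≤ a ^ 2 * (k : ℝ) ^ 2 :=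
    le_mul_of_one_le_left (sq_nonneg _) (one_le_pow₀ ha)
  nlinarith

theorem freq_pos (ha : 1 ≤ a) (hb : 2 * |b| ≤ 1) (k : ℕ+) : 0 < freq a b k :=
  Real.sqrt_pos.mpr (lt_of_lt_of_le (by have := one_le_coe k; positivity) (sq_div_four_le ha hb k))

theorem sq_freq (ha : 1 ≤ a) (hb : 2 * |b| ≤ 1) (k : ℕ+) :
    freq a b k ^ 2 = a ^ 2 * (k : ℝ) ^ 2 - b ^ 2 :=
  Real.sq_sqrt (le_trans (by positivity) (sq_div_four_le ha hb k))

theorem abs_div_freq_le (ha : 1 ≤ a) (hb : 2 * |b| ≤ 1) (k : ℕ+) : |b / freq a b k| ≤ 1 := by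
  have h0 := freq_pos ha hb k
  rw [abs_div, abs_of_pos h0, div_le_one h0]
  refine abs_le_of_sq_le_sq' ?_ h0.le |> fun h => abs_le.mpr h
  rw [sq_freq ha hb]
  have h1 := one_le_coe k
  have h2 : b ^ 2 ≤ 1 / 4 := by rw [← sq_abs]; nlinarith [abs_nonneg b]
  have := le_mul_of_one_le_left (sq_nonneg (k : ℝ)) (one_le_pow₀ ha (n := 2))
  nlinarith

end Frequency

variable {Ω : Type*}

/-! ### Versions of the noise with continuous paths -/

section Regularization

/-- The process `w`, with the paths that are not continuous or do not start at zero replaced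
by zero. -/
noncomputable def regularize (w : ℝ≥0 → Ω → ℝ) (t : ℝ≥0) : Ω → ℝ :=
  {ω | Continuous (fun t => w t ω) ∧ w 0 ω = 0}.indicator (w t)

theorem regularize_of_mem {w : ℝ≥0 → Ω → ℝ} {ω : Ω}
    (h : Continuous (fun t => w t ω) ∧ w 0 ω = 0) (t : ℝ≥0) : regularize w t ω = w t ω :=
  indicator_of_mem (s := {ω | Continuous (fun t => w t ω) ∧ w 0 ω = 0}) h _

theorem regularize_of_notMem {w : ℝ≥0 → Ω → ℝ} {ω : Ω}
    (h : ¬(Continuous (fun t => w t ω) ∧ w 0 ω = 0)) (t : ℝ≥0) : regularize w t ω = 0 :=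
  indicator_of_notMem (s := {ω | Continuous (fun t => w t ω) ∧ w 0 ω = 0}) h _

theorem continuous_regularize (w : ℝ≥0 → Ω → ℝ) (ω : Ω) :
    Continuous fun t => regularize w t ω := by
  by_cases h : Continuous (fun t => w t ω) ∧ w 0 ω = 0
  · simpa only [regularize_of_mem h] using h.1
  · simpa only [regularize_of_notMem h] using continuous_const

theorem regularize_zero (w : ℝ≥0 → Ω → ℝ) (ω : Ω) : regularize w 0 ω = 0 := by
  by_cases h : Continuous (fun t => w t ω) ∧ w 0 ω = 0
  · rw [regularize_of_mem h, h.2]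
  · rw [regularize_of_notMem h]

variable {m : MeasurableSpace Ω} {P : Measure Ω} {𝓕 : Filtration ℝ≥0 m}

/-- Completeness puts the null complement into `𝓕 0`. Processes may thus be altered on null sets
without losing adaptedness. -/
theorem UsualConditions.measurableSet_of_ae (h𝓕 : UsualConditions P 𝓕) {s : Set Ω}
    (hs : ∀ᵐ ω ∂P, ω ∈ s) (t : ℝ≥0) : MeasurableSet[𝓕 t] s := by
  have h0 : MeasurableSet[𝓕 0] sᶜ := h𝓕.complete _ (by rwa [← mem_ae_iff])
  have := 𝓕.mono (zero_le : 0 ≤ t) _ h0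
  simpa using this.compl

namespace IsCylindricalBrownianMotion

variable {H : Type*} [NormedAddCommGroup H] [InnerProductSpace ℝ H] {W : H → ℝ≥0 → Ω → ℝ}

theorem measurable (hW : IsCylindricalBrownianMotion P 𝓕 W) (e : H) (t : ℝ≥0) :
    Measurable (W e t) := (hW.adapted e t).mono (𝓕.le t) le_rfl

theorem hasGaussianLaw (hW : IsCylindricalBrownianMotion P 𝓕 W) (e : H) (t : ℝ≥0) :
    HasGaussianLaw (W e t) P := hW.gaussian.hasGaussianLaw_eval (e, t)

theorem ae_eq_zero (hW : IsCylindricalBrownianMotion P 𝓕 W) (e : H) : W e 0 =ᵐ[P] 0 := by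
  have h := hW.covariance e e 0 0
  rw [min_self, NNReal.coe_zero, zero_mul] at h
  have h2 := (integral_eq_zero_iff_of_nonneg (fun ω => mul_self_nonneg (W e 0 ω))
    ((hW.hasGaussianLaw e 0).memLp_two.integrable_mul (hW.hasGaussianLaw e 0).memLp_two)).mp h
  filter_upwards [h2] with ω hω
  exact mul_self_eq_zero.mp hω

theorem ae_regular (hW : IsCylindricalBrownianMotion P 𝓕 W) (e : H) :
    ∀ᵐ ω ∂P, Continuous (fun t => W e t ω) ∧ W e 0 ω = 0 := by
  filter_upwards [hW.continuous_paths e, hW.ae_eq_zero e] with ω h1 h2 using ⟨h1, h2⟩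

theorem measurable_regularize (hW : IsCylindricalBrownianMotion P 𝓕 W)
    (h𝓕 : UsualConditions P 𝓕) (e : H) (t : ℝ≥0) : Measurable[𝓕 t] (regularize (W e) t) :=
  (hW.adapted e t).indicator (h𝓕.measurableSet_of_ae (hW.ae_regular e) t)

theorem isBrownian_regularize (hW : IsCylindricalBrownianMotion P 𝓕 W)
    (h𝓕 : UsualConditions P 𝓕) {e : H} (he : ‖e‖ = 1) : IsBrownian P (regularize (W e)) := by
  have hae : ∀ t, W e t =ᵐ[P] regularize (W e) t := fun t => by
    filter_upwards [hW.ae_regular e] with ω hω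
    rw [regularize_of_mem hω]
  refine ⟨fun t => (hW.measurable_regularize h𝓕 e t).mono (𝓕.le t) le_rfl,
    (hW.gaussian.comp_right fun t => (e, t)).congr hae, fun t => ?_, fun t s => ?_,
    continuous_regularize _, regularize_zero _⟩
  · rw [← hW.mean_zero e t]
    exact integral_congr_ae (hae t).symm
  · have := hW.covariance e e t s
    rw [real_inner_self_eq_norm_sq, he, one_pow, mul_one] at this
    rw [← this]
    exact integral_congr_ae ((hae t).symm.mul (hae s).symm)

end IsCylindricalBrownianMotion

end Regularization

/-! ### Measurability and adaptedness of path integrals -/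

section Measurability

variable {m : MeasurableSpace Ω} {B : ℝ≥0 → Ω → ℝ} {φ φ' : ℝ → ℝ}

theorem measurable_pathIntegral (hB : ∀ t, Measurable (B t))
    (hBc : ∀ ω, Continuous fun t => B t ω) (hφ' : Continuous φ') (t : ℝ) :
    Measurable fun ω => pathIntegral φ φ' (IsBrownian.path B ω) t := by
  have hj : StronglyMeasurable (Function.uncurry fun (r : ℝ) (ω : Ω) => φ' r * B r.toNNReal ω) := by
    refine (measurable_uncurry_of_continuous_of_measurable (fun ω => ?_)
      fun r => ?_).stronglyMeasurable
    · exact hφ'.mul ((hBc ω).comp continuous_real_toNNReal)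
    · exact (hB _).const_mul _
  have hi : Measurable fun ω => ∫ r in (0 : ℝ)..t, φ' r * B r.toNNReal ω := by
    simp only [intervalIntegral]
    exact (hj.integral_prod_left.measurable).sub (hj.integral_prod_left.measurable)
  exact ((hB _).const_mul _).sub hi

/-- The process stopped at `t` is `𝓕 t`-measurable at every time and has the same integral up to
`t`, so the result without filtration applies with the σ-algebra `𝓕 t`. -/
theorem measurable_pathIntegral_of_adapted {B : ℝ≥0 → Ω → ℝ} {𝓕 : Filtration ℝ≥0 m}
    (hB : ∀ t, Measurable[𝓕 t] (B t)) (hBc : ∀ ω, Continuous fun t => B t ω)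
    (hφ' : Continuous φ') (t : ℝ≥0) :
    Measurable[𝓕 t] fun ω => pathIntegral φ φ' (IsBrownian.path B ω) t := by
  have h := @measurable_pathIntegral Ω (𝓕 t) (fun s => B (min s t)) φ φ'
    (fun s => (hB _).mono (𝓕.mono (min_le_right s t)) le_rfl)
    (fun ω => (hBc ω).comp (continuous_id.min continuous_const)) hφ' t
  have e : ∀ ω, pathIntegral φ φ' (IsBrownian.path (fun s => B (min s t)) ω) t
      = pathIntegral φ φ' (IsBrownian.path B ω) t := by
    intro ω
    have hr : ∀ r ≤ (t : ℝ), IsBrownian.path (fun s => B (min s t)) ω r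
        = IsBrownian.path B ω r := by
      intro r hr
      simp only [IsBrownian.path]
      rw [min_eq_left (by rwa [Real.toNNReal_le_iff_le_coe])]
    simp only [pathIntegral]
    rw [hr t le_rfl]
    congr 1
    refine intervalIntegral.integral_congr fun r hr' => ?_
    rw [uIcc_of_le t.coe_nonneg] at hr'
    simp only [hr r hr'.2]
  simpa only [e] using h

end Measurability

end StochWave

namespace StochWave

/-! ### Uniform moment bounds and construction of the modes -/

section Modes

variable {Ω : Type*} {m : MeasurableSpace Ω} {P : Measure Ω}

/-- A bound, up to the factor `k⁻²` for the position, of the squares of the position, the velocity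
and the driving path of the mode with frequency `κ` on `[0, T]`. -/
noncomputable def modeBound (b κ T : ℝ) (w : ℝ → ℝ) : ℝ≥0∞ :=
  ENNReal.ofReal (4 * Real.exp T ^ 2) * (chainingBound T (cosIntegral b κ w)
    + chainingBound T (sinIntegral b κ w) + chainingBound T w)

/-- A bound of the expectation of `modeBound`. -/
noncomputable def modeConst (T : ℝ) : ℝ≥0∞ :=
  ENNReal.ofReal (4 * Real.exp T ^ 2)
    * (3 * chainingConst (momentConst * (Real.exp T ^ 2) ^ 2 * T ^ 2))

theorem modeConst_ne_top (T : ℝ) : modeConst T ≠ ∞ :=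
  ENNReal.mul_ne_top ENNReal.ofReal_ne_top (ENNReal.mul_ne_top (by norm_num)
    (chainingConst_ne_top (by have := momentConst_pos; positivity)))

section Path

variable {b κ T : ℝ} {w : ℝ → ℝ}

theorem ofReal_sq_add_sq_le_modeBound (hT : 0 < T) (hw : Continuous w) (hw0 : w 0 = 0) {t : ℝ}
    (ht : t ∈ Icc 0 T) :
    ENNReal.ofReal (4 * Real.exp T ^ 2 * (cosIntegral b κ w t ^ 2 + sinIntegral b κ w t ^ 2))
      ≤ modeBound b κ T w := by
  rw [ENNReal.ofReal_mul (by positivity), ENNReal.ofReal_add (sq_nonneg _) (sq_nonneg _), modeBound]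
  refine mul_le_mul_right (le_trans ?_ le_self_add) _
  exact add_le_add
    (ofReal_sq_le_chainingBound hT (pathIntegral_zero _ _ hw0)
      (continuous_pathIntegral (hasDerivAt_expCos b κ) (continuous_expCosDeriv b κ) hw) ht)
    (ofReal_sq_le_chainingBound hT (pathIntegral_zero _ _ hw0)
      (continuous_pathIntegral (hasDerivAt_expSin b κ) (continuous_expSinDeriv b κ) hw) ht)

theorem ofReal_sq_path_le_modeBound (hT : 0 < T) (hw : Continuous w) (hw0 : w 0 = 0) {t : ℝ}
    (ht : t ∈ Icc 0 T) : ENNReal.ofReal (w t ^ 2) ≤ modeBound b κ T w := by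
  have h1 : (1 : ℝ≥0∞) ≤ ENNReal.ofReal (4 * Real.exp T ^ 2) := by
    rw [ENNReal.one_le_ofReal]
    nlinarith [Real.one_le_exp hT.le]
  calc _ ≤ chainingBound T w := ofReal_sq_le_chainingBound hT hw0 hw ht
    _ ≤ 1 * (chainingBound T (cosIntegral b κ w) + chainingBound T (sinIntegral b κ w)
        + chainingBound T w) := by rw [one_mul]; exact le_add_self
    _ ≤ _ := by unfold modeBound; gcongr

end Path

variable {B : ℝ≥0 → Ω → ℝ}

theorem measurable_path (hB : IsBrownian P B) (t : ℝ) :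
    Measurable fun ω => IsBrownian.path B ω t := hB.measurable _

theorem measurable_modeBound (hB : IsBrownian P B) (b κ T : ℝ) :
    Measurable fun ω => modeBound b κ T (IsBrownian.path B ω) := by
  refine (((measurable_chainingBound (fun t => ?_) T).add
    (measurable_chainingBound (fun t => ?_) T)).add
    (measurable_chainingBound (measurable_path hB) T)).const_mul _
  · exact measurable_pathIntegral hB.measurable hB.continuous (continuous_expCosDeriv b κ) t
  · exact measurable_pathIntegral hB.measurable hB.continuous (continuous_expSinDeriv b κ) t

theorem lintegral_modeBound_le [IsProbabilityMeasure P] (hB : IsBrownian P B) {b κ T : ℝ}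
    (hT : 0 < T) (hb : |b| ≤ 1) :
    ∫⁻ ω, modeBound b κ T (IsBrownian.path B ω) ∂P ≤ modeConst T := by
  have hgen : ∀ φ φ' : ℝ → ℝ, (∀ t, HasDerivAt φ (φ' t) t) → Continuous φ' →
      (∀ t ∈ Icc 0 T, |φ t| ≤ Real.exp T) →
      Measurable (fun ω => chainingBound T (pathIntegral φ φ' (IsBrownian.path B ω))) ∧
      ∫⁻ ω, chainingBound T (pathIntegral φ φ' (IsBrownian.path B ω)) ∂P
        ≤ chainingConst (momentConst * (Real.exp T ^ 2) ^ 2 * T ^ 2) := by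
    intro φ φ' h1 h2 h3
    have hm := measurable_pathIntegral (φ := φ) hB.measurable hB.continuous h2
    refine ⟨measurable_chainingBound hm T, lintegral_chainingBound_le hm hT
      (by have := momentConst_pos; positivity) fun s t hs hst ht => ?_⟩
    refine (hB.lintegral_pathIntegral_sub_pow_four_le h1 h2 (Real.exp_pos T) h3 hs hst ht).trans_eq
      ?_
    congr 1; ring
  obtain ⟨m1, l1⟩ := hgen _ _ (hasDerivAt_expCos b κ) (continuous_expCosDeriv b κ)
    (fun t ht => abs_expCos_le hb ht)
  obtain ⟨m2, l2⟩ := hgen _ _ (hasDerivAt_expSin b κ) (continuous_expSinDeriv b κ)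
    (fun t ht => abs_expSin_le hb ht)
  -- The constant integrand `1 ≤ e^T` recovers the driving path, so the same estimate bounds it.
  obtain ⟨m3, l3⟩ := hgen (fun _ => 1) (fun _ => 0) (fun t => hasDerivAt_const t 1)
    continuous_const (fun t _ => by simpa using hT.le)
  have e3 : ∀ ω, pathIntegral (fun _ => 1) (fun _ => 0) (IsBrownian.path B ω)
      = IsBrownian.path B ω := fun ω => by ext t; simp [pathIntegral]
  simp only [e3] at m3 l3
  unfold modeBound modeConst
  rw [lintegral_const_mul' _ _ ENNReal.ofReal_ne_top]
  gcongr
  rw [lintegral_add_right _ m3]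
  have h12 : ∫⁻ ω, (chainingBound T (cosIntegral b κ (IsBrownian.path B ω))
      + chainingBound T (sinIntegral b κ (IsBrownian.path B ω))) ∂P
      = ∫⁻ ω, chainingBound T (cosIntegral b κ (IsBrownian.path B ω)) ∂P
        + ∫⁻ ω, chainingBound T (sinIntegral b κ (IsBrownian.path B ω)) ∂P :=
    lintegral_add_right _ m2
  rw [h12]
  calc _ ≤ _ := add_le_add (add_le_add l1 l2) l3
    _ = _ := by ring

/-- The processes `u k` and `v k` are the coefficients of the position and the velocity of the
solution of the damped stochastic wave equation on `[0, T]`, and `R k` bounds them. -/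
structure IsModalSolution (P : Measure Ω) (𝓕 : Filtration ℝ≥0 m) (W : L2pi → ℝ≥0 → Ω → ℝ)
    (a b T : ℝ) (u v : ℕ+ → ℝ → Ω → ℝ) (R : ℕ+ → Ω → ℝ≥0∞) (C : ℝ≥0∞) : Prop where
  adapted_u : ∀ k (t : ℝ≥0), (t : ℝ) ≤ T → Measurable[𝓕 t] (u k t)
  adapted_v : ∀ k (t : ℝ≥0), (t : ℝ) ≤ T → Measurable[𝓕 t] (v k t)
  measurable_u : ∀ k t, Measurable (u k t)
  measurable_v : ∀ k t, Measurable (v k t)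
  continuous_u : ∀ k ω, Continuous fun t => u k t ω
  continuous_v : ∀ k ω, Continuous fun t => v k t ω
  measurable_R : ∀ k, Measurable (R k)
  lintegral_R : ∀ k, ∫⁻ ω, R k ω ∂P ≤ C
  const_ne_top : C ≠ ∞
  tsum_ne_top : ∀ ω, ∑' k : ℕ+, ENNReal.ofReal (((k : ℝ) ^ 2)⁻¹) * R k ω ≠ ∞
  sq_u_le : ∀ k t ω, ENNReal.ofReal (u k t ω ^ 2) ≤ ENNReal.ofReal (((k : ℝ) ^ 2)⁻¹) * R k ω
  sq_v_le : ∀ k t ω, ENNReal.ofReal (v k t ω ^ 2) ≤ R k ω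
  equations : ∀ᵐ ω ∂P, ∀ k, ∀ t ∈ Icc 0 T,
    u k t ω = ∫ s in (0 : ℝ)..t, v k s ω ∧
    v k t ω = (∫ s in (0 : ℝ)..t, (-(a ^ 2 * (k : ℝ) ^ 2) * u k s ω - 2 * b * v k s ω))
      + W (sineL2 k) t.toNNReal ω ∧
    ENNReal.ofReal (W (sineL2 k) t.toNNReal ω ^ 2) ≤ R k ω

theorem summable_inv_sq : Summable fun k : ℕ+ => ((k : ℝ) ^ 2)⁻¹ := by
  have h : Summable fun n : ℕ => ((n : ℝ) ^ 2)⁻¹ := Real.summable_nat_pow_inv.mpr (by norm_num)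
  exact h.comp_injective PNat.coe_injective

theorem measurable_oscPosition {m' : MeasurableSpace Ω} {w : Ω → ℝ → ℝ} {b κ t : ℝ}
    (h1 : Measurable fun ω => cosIntegral b κ (w ω) t)
    (h2 : Measurable fun ω => sinIntegral b κ (w ω) t) :
    Measurable fun ω => oscPosition b κ (w ω) t := by
  unfold oscPosition; fun_prop

theorem measurable_oscVelocity {m' : MeasurableSpace Ω} {w : Ω → ℝ → ℝ} {b κ t : ℝ}
    (h1 : Measurable fun ω => cosIntegral b κ (w ω) t)
    (h2 : Measurable fun ω => sinIntegral b κ (w ω) t) :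
    Measurable fun ω => oscVelocity b κ (w ω) t := by
  unfold oscVelocity; fun_prop

/-- The modes are the explicit oscillators, set to zero off the full-measure event `G` where `∑ k⁻²
R_k` is finite. The series bound then holds for every `ω`, and adaptedness survives by completeness.
Time is clamped to `[0, T]` so that the bounds hold for every real `t`. -/
theorem exists_isModalSolution [IsProbabilityMeasure P] {𝓕 : Filtration ℝ≥0 m}
    (h𝓕 : UsualConditions P 𝓕) {W : L2pi → ℝ≥0 → Ω → ℝ}
    (hW : IsCylindricalBrownianMotion P 𝓕 W) {a b T : ℝ} (ha : 1 ≤ a) (hb : 2 * |b| ≤ 1)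
    (hT : 0 < T) : ∃ u v R C, IsModalSolution P 𝓕 W a b T u v R C := by
  have hb1 : |b| ≤ 1 := by linarith [abs_nonneg b]
  set B : ℕ+ → ℝ≥0 → Ω → ℝ := fun k => regularize (W (sineL2 k)) with hBdef
  have hB : ∀ k, IsBrownian P (B k) := fun k =>
    hW.isBrownian_regularize h𝓕 (orthonormal_sineL2.1 k)
  have hBa : ∀ k t, Measurable[𝓕 t] (B k t) := fun k t =>
    hW.measurable_regularize h𝓕 (sineL2 k) t
  set w : ℕ+ → Ω → ℝ → ℝ := fun k ω => IsBrownian.path (B k) ω with hw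
  have wc : ∀ k ω, Continuous (w k ω) := fun k ω => (hB k).continuous_path ω
  have w0 : ∀ k ω, w k ω 0 = 0 := fun k ω => (hB k).path_zero ω
  set R₀ : ℕ+ → Ω → ℝ≥0∞ := fun k ω => modeBound b (freq a b k) T (w k ω) with hR₀
  have mR₀ : ∀ k, Measurable (R₀ k) := fun k => measurable_modeBound (hB k) _ _ _
  have lR₀ : ∀ k, ∫⁻ ω, R₀ k ω ∂P ≤ modeConst T := fun k => lintegral_modeBound_le (hB k) hT hb1
  set S : Ω → ℝ≥0∞ := fun ω => ∑' k : ℕ+, ENNReal.ofReal (((k : ℝ) ^ 2)⁻¹) * R₀ k ω with hS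
  have mS : Measurable S := Measurable.tsum fun k => (mR₀ k).const_mul _
  set G : Set Ω := {ω | S ω ≠ ∞} with hG
  have mG : MeasurableSet G := (measurableSet_eq_fun mS measurable_const).compl
  have aeG : ∀ᵐ ω ∂P, ω ∈ G := by
    have : ∫⁻ ω, S ω ∂P ≠ ∞ := by
      rw [lintegral_tsum fun k => ((mR₀ k).const_mul _).aemeasurable]
      refine ne_top_of_le_ne_top (b := (∑' k : ℕ+, ENNReal.ofReal (((k : ℝ) ^ 2)⁻¹)) * modeConst T)
        (ENNReal.mul_ne_top ?_ (modeConst_ne_top T)) ?_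
      · rw [← ENNReal.ofReal_tsum_of_nonneg (fun k => by positivity) summable_inv_sq]
        exact ENNReal.ofReal_ne_top
      · rw [← ENNReal.tsum_mul_right]
        refine ENNReal.tsum_le_tsum fun k => ?_
        rw [lintegral_const_mul' _ _ ENNReal.ofReal_ne_top]
        gcongr
        exact lR₀ k
    filter_upwards [ae_lt_top mS this] with ω hω using hω.ne
  have hGa : ∀ t, MeasurableSet[𝓕 t] G := h𝓕.measurableSet_of_ae aeG
  have hκ : ∀ k, freq a b k ≠ 0 := fun k => (freq_pos ha hb k).ne'
  have hsq : ∀ k t ω, ENNReal.ofReal (4 * Real.exp T ^ 2 *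
      (cosIntegral b (freq a b k) (w k ω) (clamp T t) ^ 2
        + sinIntegral b (freq a b k) (w k ω) (clamp T t) ^ 2)) ≤ R₀ k ω := fun k t ω =>
    ofReal_sq_add_sq_le_modeBound hT (wc k ω) (w0 k ω) (clamp_mem hT.le t)
  have sqU : ∀ k t ω, ENNReal.ofReal (oscPosition b (freq a b k) (w k ω) (clamp T t) ^ 2)
      ≤ ENNReal.ofReal (((k : ℝ) ^ 2)⁻¹) * R₀ k ω := by
    intro k t ω
    refine le_trans ?_ (mul_le_mul_right (hsq k t ω) _)
    rw [← ENNReal.ofReal_mul (by positivity)]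
    refine ENNReal.ofReal_le_ofReal ((sq_oscPosition_le hb1 (clamp_mem hT.le t)).trans ?_)
    rw [← mul_assoc]
    refine mul_le_mul_of_nonneg_right ?_ (by positivity)
    rw [sq_freq ha hb, inv_mul_eq_div]
    have h1 := sq_div_four_le ha hb k
    have h2 : (0 : ℝ) < (k : ℝ) ^ 2 := by have := one_le_coe k; positivity
    -- The factor `4` in `modeBound` absorbs the `4` of `κ² ≥ k²/4`.
    rw [div_le_div_iff₀ (by linarith) h2]
    nlinarith [sq_nonneg (Real.exp T)]
  have sqV : ∀ k t ω, ENNReal.ofReal (oscVelocity b (freq a b k) (w k ω) (clamp T t) ^ 2)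
      ≤ R₀ k ω := fun k t ω =>
    (ENNReal.ofReal_le_ofReal (sq_oscVelocity_le hb1 (abs_div_freq_le ha hb k)
      (clamp_mem hT.le t))).trans (hsq k t ω)
  have mc : ∀ k t, Measurable fun ω => cosIntegral b (freq a b k) (w k ω) t := fun k =>
    measurable_pathIntegral (hB k).measurable (hB k).continuous (continuous_expCosDeriv _ _)
  have ms : ∀ k t, Measurable fun ω => sinIntegral b (freq a b k) (w k ω) t := fun k =>
    measurable_pathIntegral (hB k).measurable (hB k).continuous (continuous_expSinDeriv _ _)
  have ac : ∀ k (t : ℝ≥0), Measurable[𝓕 t] fun ω => cosIntegral b (freq a b k) (w k ω) t :=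
    fun k => measurable_pathIntegral_of_adapted (hBa k) (hB k).continuous
      (continuous_expCosDeriv _ _)
  have as : ∀ k (t : ℝ≥0), Measurable[𝓕 t] fun ω => sinIntegral b (freq a b k) (w k ω) t :=
    fun k => measurable_pathIntegral_of_adapted (hBa k) (hB k).continuous
      (continuous_expSinDeriv _ _)
  have hcl : ∀ t : ℝ≥0, (t : ℝ) ≤ T → clamp T t = t := fun t ht => clamp_of_mem ⟨t.coe_nonneg, ht⟩
  refine ⟨fun k t => G.indicator fun ω => oscPosition b (freq a b k) (w k ω) (clamp T t),
    fun k t => G.indicator fun ω => oscVelocity b (freq a b k) (w k ω) (clamp T t),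
    fun k => G.indicator (R₀ k), modeConst T, ?_⟩
  refine
    { adapted_u := fun k t ht => ?_
      adapted_v := fun k t ht => ?_
      measurable_u := fun k t => (measurable_oscPosition (mc k _) (ms k _)).indicator mG
      measurable_v := fun k t => (measurable_oscVelocity (mc k _) (ms k _)).indicator mG
      continuous_u := fun k ω => ?_
      continuous_v := fun k ω => ?_
      measurable_R := fun k => (mR₀ k).indicator mG
      lintegral_R := fun k => (lintegral_mono (indicator_le_self _ _)).trans (lR₀ k)
      const_ne_top := modeConst_ne_top T
      tsum_ne_top := fun ω => ?_
      sq_u_le := fun k t ω => ?_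
      sq_v_le := fun k t ω => ?_
      equations := ?_ }
  · rw [hcl t ht]
    exact (measurable_oscPosition (ac k t) (as k t)).indicator (hGa t)
  · rw [hcl t ht]
    exact (measurable_oscVelocity (ac k t) (as k t)).indicator (hGa t)
  · by_cases h : ω ∈ G
    · simp only [indicator_of_mem h]
      exact (continuous_oscPosition (hκ k) (wc k ω)).comp (continuous_clamp T)
    · simp only [indicator_of_notMem h]
      exact continuous_const
  · by_cases h : ω ∈ G
    · simp only [indicator_of_mem h]
      exact (continuous_oscVelocity (hκ k) (wc k ω)).comp (continuous_clamp T)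
    · simp only [indicator_of_notMem h]
      exact continuous_const
  · by_cases h : ω ∈ G
    · simp only [indicator_of_mem h]
      exact h
    · simp [indicator_of_notMem h]
  · by_cases h : ω ∈ G
    · simp only [indicator_of_mem h]
      exact sqU k t ω
    · simp [indicator_of_notMem h]
  · by_cases h : ω ∈ G
    · simp only [indicator_of_mem h]
      exact sqV k t ω
    · simp [indicator_of_notMem h]
  · have hreg : ∀ᵐ ω ∂P, ∀ k t, B k t ω = W (sineL2 k) t ω := by
      rw [ae_all_iff]
      intro k
      filter_upwards [hW.ae_regular (sineL2 k)] with ω hω t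
      exact regularize_of_mem hω t
    filter_upwards [aeG, hreg] with ω h hBW k t ht
    simp only [indicator_of_mem h]
    have hcs : ∀ s ∈ uIcc 0 t, clamp T s = s := fun s hs => by
      rw [uIcc_of_le ht.1] at hs
      exact clamp_of_mem (Icc_subset_Icc_right ht.2 hs)
    rw [clamp_of_mem ht, ← hBW k]
    refine ⟨?_, ?_, ofReal_sq_path_le_modeBound hT (wc k ω) (w0 k ω) ht⟩
    · rw [oscPosition_eq_integral (hκ k) (wc k ω) (w0 k ω)]
      exact intervalIntegral.integral_congr fun s hs => by simp only [hcs s hs]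
    · rw [oscVelocity_eq_integral (hκ k) (wc k ω) (w0 k ω)]
      congr 1
      refine intervalIntegral.integral_congr fun s hs => ?_
      simp only [hcs s hs, sq_freq ha hb]
      ring

end Modes

end StochWave

namespace StochWave

variable {Ω : Type*} {m : MeasurableSpace Ω} {P : Measure Ω}

/-! ### Expansion of the noise -/

theorem abs_mul_le_sq_add_sq (x y : ℝ) : |x * y| ≤ x ^ 2 + y ^ 2 := by
  rw [abs_le]
  constructor <;> nlinarith [sq_nonneg (x + y), sq_nonneg (x - y), sq_nonneg x, sq_nonneg y]

/-- The `H¹`–`H⁻¹` pairing termwise: with `y = f_k` and `r = R_k` both terms on the right are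
summable and free of time, so they serve as majorants throughout. -/
theorem abs_mul_le_inv_sq_mul {x r : ℝ} (hx : x ^ 2 ≤ r) (y : ℝ) (k : ℕ+) :
    |y * x| ≤ (k * y) ^ 2 + ((k : ℝ) ^ 2)⁻¹ * r := by
  have hk : (0 : ℝ) < k := by exact_mod_cast k.pos
  have e : y * x = k * y * (x / k) := by field_simp
  rw [e]
  refine (abs_mul_le_sq_add_sq _ _).trans ?_
  rw [div_pow, div_eq_inv_mul]
  gcongr

theorem IsTestFunction.summable_mul_sq {f : ℝ → ℝ} (hf : IsTestFunction f) :
    Summable fun k : ℕ+ => ((k : ℝ) * sineCoeff f k) ^ 2 := by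
  refine Summable.of_nonneg_of_le (fun k => sq_nonneg _) (fun k => ?_) hf.summable_sq
  have := one_le_coe k
  rw [mul_pow, mul_pow]
  gcongr
  exact le_self_pow₀ this two_ne_zero

namespace IsCylindricalBrownianMotion

variable {𝓕 : Filtration ℝ≥0 m} {H : Type*} [NormedAddCommGroup H] [InnerProductSpace ℝ H]
  {W : H → ℝ≥0 → Ω → ℝ}

theorem ae_sum (hW : IsCylindricalBrownianMotion P 𝓕 W) {ι : Type*} (s : Finset ι) (c : ι → ℝ)
    (e : ι → H) (t : ℝ≥0) :
    ∀ᵐ ω ∂P, W (∑ i ∈ s, c i • e i) t ω = ∑ i ∈ s, c i * W (e i) t ω := by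
  classical
  induction s using Finset.induction_on with
  | empty =>
    filter_upwards [hW.smul 0 0 t] with ω hω
    simpa using hω
  | insert i s hi ih =>
    rw [Finset.sum_insert hi]
    filter_upwards [ih, hW.add (c i • e i) (∑ i ∈ s, c i • e i) t, hW.smul (c i) (e i) t]
      with ω h1 h2 h3
    rw [h2, Finset.sum_insert hi, Pi.add_apply, h1, h3]
    simp

theorem lintegral_sq (hW : IsCylindricalBrownianMotion P 𝓕 W) (g : H) (t : ℝ≥0) :
    ∫⁻ ω, ENNReal.ofReal (W g t ω ^ 2) ∂P = ENNReal.ofReal (t * ‖g‖ ^ 2) := by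
  have h := hW.covariance g g t t
  rw [min_self, real_inner_self_eq_norm_sq] at h
  have hi : Integrable (fun ω => W g t ω * W g t ω) P :=
    (hW.hasGaussianLaw g t).memLp_two.integrable_mul (hW.hasGaussianLaw g t).memLp_two
  rw [← h, ofReal_integral_eq_lintegral_ofReal hi
    (Filter.Eventually.of_forall fun ω => mul_self_nonneg _)]
  simp only [sq]

/-- The expansion of the noise at a fixed time. -/
theorem ae_eq_tsum (hW : IsCylindricalBrownianMotion P 𝓕 W) {ι : Type*} [Countable ι] {c : ι → ℝ}
    {e : ι → H} {g : H} (hg : HasSum (fun i => c i • e i) g) (t : ℝ≥0)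
    (hs : ∀ᵐ ω ∂P, Summable fun i => c i * W (e i) t ω) :
    ∀ᵐ ω ∂P, W g t ω = ∑' i, c i * W (e i) t ω := by
  set Z : Finset ι → Ω → ℝ≥0∞ := fun s ω =>
    ENNReal.ofReal ((W g t ω - ∑ i ∈ s, c i * W (e i) t ω) ^ 2) with hZ
  have mZ : ∀ s, Measurable (Z s) := fun s =>
    (((hW.measurable g t).sub (Finset.measurable_sum _ fun i _ =>
      (hW.measurable (e i) t).const_mul _)).pow_const 2).ennreal_ofReal
  -- By almost sure linearity the remainder is the noise of the tail of the series, whose second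
  -- moment is given by the covariance.
  have lZ : ∀ s, ∫⁻ ω, Z s ω ∂P = ENNReal.ofReal (t * ‖g - ∑ i ∈ s, c i • e i‖ ^ 2) := by
    intro s
    rw [← hW.lintegral_sq]
    refine lintegral_congr_ae ?_
    filter_upwards [hW.ae_sum s c e t,
      hW.add (g - ∑ i ∈ s, c i • e i) (∑ i ∈ s, c i • e i) t] with ω h1 h2
    rw [sub_add_cancel, Pi.add_apply, h1] at h2
    simp only [hZ, h2, add_sub_cancel_right]
  have hlim : Filter.Tendsto (fun s : Finset ι => ∫⁻ ω, Z s ω ∂P) Filter.atTop (nhds 0) := by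
    simp only [lZ]
    have h1 : Filter.Tendsto (fun s : Finset ι => (t : ℝ) * ‖g - ∑ i ∈ s, c i • e i‖ ^ 2)
        Filter.atTop (nhds (t * ‖g - g‖ ^ 2)) :=
      (((tendsto_const_nhds.sub hg).norm).pow 2).const_mul _
    simpa using ENNReal.tendsto_ofReal h1
  -- Fatou's lemma is applied along a sequence of finite sets; the assumed summability identifies
  -- the pathwise limit.
  obtain ⟨σ, hσ⟩ := Filter.exists_seq_tendsto (Filter.atTop : Filter (Finset ι))
  have hfatou : ∫⁻ ω, Filter.liminf (fun n => Z (σ n) ω) Filter.atTop ∂P = 0 :=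
    le_antisymm ((lintegral_liminf_le fun n => mZ (σ n)).trans_eq (hlim.comp hσ).liminf_eq) bot_le
  have hzero := (lintegral_eq_zero_iff' (Measurable.liminf fun n => mZ (σ n)).aemeasurable).mp
    hfatou
  filter_upwards [hzero, hs] with ω h1 h2
  have h3 : Filter.Tendsto (fun s => Z s ω) Filter.atTop
      (nhds (ENNReal.ofReal ((W g t ω - ∑' i, c i * W (e i) t ω) ^ 2))) :=
    ENNReal.tendsto_ofReal ((tendsto_const_nhds.sub h2.hasSum).pow 2)
  have h5 := (h3.comp hσ).liminf_eq.symm.trans h1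
  have h4 : (W g t ω - ∑' i, c i * W (e i) t ω) ^ 2 ≤ 0 := ENNReal.ofReal_eq_zero.mp h5
  exact sub_eq_zero.mp (pow_eq_zero_iff two_ne_zero |>.mp (le_antisymm h4 (sq_nonneg _)))

/-- The expansion of the noise, simultaneously at all times in `[0, T]`. -/
theorem ae_forall_hasSum (hW : IsCylindricalBrownianMotion P 𝓕 W) {ι : Type*} [Countable ι]
    {c : ι → ℝ} {e : ι → H} {g : H} (hg : HasSum (fun i => c i • e i) g) {T : ℝ≥0}
    (hs : ∀ᵐ ω ∂P, ∃ M : ι → ℝ, Summable M ∧ ∀ i, ∀ t ≤ T, |c i * W (e i) t ω| ≤ M i) :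
    ∀ᵐ ω ∂P, ∀ t ≤ T, HasSum (fun i => c i * W (e i) t ω) (W g t ω) := by
  have hd : ∀ᵐ ω ∂P, ∀ n : ℕ, W g (min (TopologicalSpace.denseSeq ℝ≥0 n) T) ω
      = ∑' i, c i * W (e i) (min (TopologicalSpace.denseSeq ℝ≥0 n) T) ω := by
    rw [ae_all_iff]
    intro n
    refine hW.ae_eq_tsum hg _ ?_
    filter_upwards [hs] with ω ⟨M, hM, hb⟩
    exact Summable.of_norm_bounded hM fun i => hb i _ (min_le_right _ _)
  have hc : ∀ᵐ ω ∂P, ∀ i, Continuous fun t => W (e i) t ω :=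
    ae_all_iff.mpr fun i => hW.continuous_paths (e i)
  filter_upwards [hd, hs, hc, hW.continuous_paths g] with ω h1 ⟨M, hM, hb⟩ h3 h4 t ht
  have hmin : Continuous fun t : ℝ≥0 => min t T := continuous_id.min continuous_const
  -- Both sides are continuous in time, the series by the Weierstrass test, and agree at countably
  -- many dense times; capping times at `T` keeps the majorant valid.
  have key := (h4.comp hmin).ext_on (TopologicalSpace.denseRange_denseSeq ℝ≥0)
    (continuous_tsum (fun i => ((h3 i).comp hmin).const_mul (c i)) hM
      fun i t => hb i _ (min_le_right _ _))
    (by rintro _ ⟨n, rfl⟩; exact h1 n)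
  have := congr_fun key t
  simp only [Function.comp_apply, min_eq_left ht] at this
  rw [this]
  exact (Summable.of_norm_bounded hM fun i => hb i t ht).hasSum

end IsCylindricalBrownianMotion

/-! ### Moments in Sobolev spaces -/

theorem summable_rpow_coe {s : ℝ} (hs : s < -1) : Summable fun k : ℕ+ => (k : ℝ) ^ s :=
  (Real.summable_nat_rpow.mpr hs).comp_injective PNat.coe_injective

/-- Tonelli and the uniform mean bound reduce the norm to `∑ k^{2(γ-δ)}`. The position uses `δ = 1`;
the velocity uses `δ = 0` with `γ - 1` for `γ`, hence the same threshold. -/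
theorem memL2Sobolev_of_sq_le [SFinite P] {c : ℝ → Ω → ℕ+ → ℝ} {R : ℕ+ → Ω → ℝ≥0∞} {C : ℝ≥0∞}
    {T γ δ : ℝ} (hc : ∀ k, Measurable fun p : Ω × ℝ => c p.2 p.1 k) (hR : ∀ k, Measurable (R k))
    (hRC : ∀ k, ∫⁻ ω, R k ω ∂P ≤ C) (hC : C ≠ ∞)
    (hcR : ∀ k t ω, ENNReal.ofReal (c t ω k ^ 2) ≤ ENNReal.ofReal ((k : ℝ) ^ (-2 * δ)) * R k ω)
    (hγ : 2 * (γ - δ) < -1) : MemL2Sobolev P T γ c := by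
  refine ⟨fun k => (hc k).aemeasurable, ?_⟩
  have hterm : ∀ (k : ℕ+) t ω, ENNReal.ofReal ((k : ℝ) ^ (2 * γ) * c t ω k ^ 2)
      ≤ ENNReal.ofReal ((k : ℝ) ^ (2 * (γ - δ))) * R k ω := by
    intro k t ω
    have hk : (0 : ℝ) < k := by exact_mod_cast k.pos
    have e : (2 * (γ - δ)) = 2 * γ + -2 * δ := by ring
    rw [e, Real.rpow_add hk, ENNReal.ofReal_mul (by positivity), ENNReal.ofReal_mul (by positivity),
      mul_assoc]
    gcongr
    exact hcR k t ω
  have hprod : ∀ k, ∫⁻ p : Ω × ℝ, R k p.1 ∂(timeMeasure P T) ≤ C * ENNReal.ofReal T := by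
    intro k
    rw [timeMeasure, lintegral_prod (fun p : Ω × ℝ => R k p.1)
      ((hR k).comp measurable_fst).aemeasurable]
    simp only [lintegral_const, Measure.restrict_apply_univ, Real.volume_Ioo, sub_zero]
    rw [lintegral_mul_const _ (hR k)]
    gcongr
    exact hRC k
  unfold sobolevNormSq
  calc ∫⁻ p : Ω × ℝ, ∑' k : ℕ+, ENNReal.ofReal ((k : ℝ) ^ (2 * γ) * c p.2 p.1 k ^ 2)
        ∂(timeMeasure P T)
      = ∑' k : ℕ+, ∫⁻ p : Ω × ℝ, ENNReal.ofReal ((k : ℝ) ^ (2 * γ) * c p.2 p.1 k ^ 2)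
        ∂(timeMeasure P T) :=
        lintegral_tsum fun k => (((hc k).pow_const 2).const_mul _).ennreal_ofReal.aemeasurable
    _ ≤ ∑' k : ℕ+, ENNReal.ofReal ((k : ℝ) ^ (2 * (γ - δ))) * (C * ENNReal.ofReal T) := by
        refine ENNReal.tsum_le_tsum fun k => ?_
        refine (lintegral_mono fun p : Ω × ℝ => hterm k p.2 p.1).trans ?_
        rw [lintegral_const_mul' _ _ ENNReal.ofReal_ne_top]
        gcongr
        exact hprod k
    _ < ∞ := by
        rw [ENNReal.tsum_mul_right, ← ENNReal.ofReal_tsum_of_nonneg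
          (fun k => Real.rpow_nonneg (Nat.cast_nonneg _) _) (summable_rpow_coe hγ)]
        exact ENNReal.mul_lt_top ENNReal.ofReal_lt_top
          (ENNReal.mul_lt_top hC.lt_top ENNReal.ofReal_lt_top)

theorem stronglyMeasurable_sineSeries {α : Type*} {m' : MeasurableSpace α} {c : α → ℕ+ → ℝ}
    (hc : ∀ k, Measurable fun x => c x k) (hs : ∀ x, Summable fun k => c x k ^ 2) :
    StronglyMeasurable fun x => sineSeries (c x) := by
  refine stronglyMeasurable_of_tendsto (Filter.atTop : Filter (Finset ℕ+))
    (f := fun s x => ∑ k ∈ s, c x k • sineL2 k) (fun s => ?_) ?_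
  · exact Finset.stronglyMeasurable_fun_sum _ fun k _ => (hc k).stronglyMeasurable.smul_const _
  · rw [tendsto_pi_nhds]
    exact fun x => hasSum_sineSeries (hs x)

/-! ### Existence -/

namespace IsModalSolution

variable {𝓕 : Filtration ℝ≥0 m} {W : L2pi → ℝ≥0 → Ω → ℝ} {a b T : ℝ} {u v : ℕ+ → ℝ → Ω → ℝ}
  {R : ℕ+ → Ω → ℝ≥0∞} {C : ℝ≥0∞}

theorem R_ne_top (h : IsModalSolution P 𝓕 W a b T u v R C) (k : ℕ+) (ω : Ω) : R k ω ≠ ∞ := by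
  intro hR
  have h1 := ENNReal.ne_top_of_tsum_ne_top (h.tsum_ne_top ω) k
  rw [hR, ENNReal.mul_top] at h1
  · exact h1 rfl
  · have := one_le_coe k
    rw [Ne, ENNReal.ofReal_eq_zero, not_le]
    positivity

theorem summable_R (h : IsModalSolution P 𝓕 W a b T u v R C) (ω : Ω) :
    Summable fun k : ℕ+ => ((k : ℝ) ^ 2)⁻¹ * (R k ω).toReal := by
  refine (ENNReal.summable_toReal (h.tsum_ne_top ω)).congr fun k => ?_
  rw [ENNReal.toReal_mul, ENNReal.toReal_ofReal (by positivity)]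

theorem sq_u_le_toReal (h : IsModalSolution P 𝓕 W a b T u v R C) (k : ℕ+) (t : ℝ) (ω : Ω) :
    u k t ω ^ 2 ≤ ((k : ℝ) ^ 2)⁻¹ * (R k ω).toReal := by
  have := h.sq_u_le k t ω
  rwa [← ENNReal.ofReal_toReal (h.R_ne_top k ω), ← ENNReal.ofReal_mul (by positivity),
    ENNReal.ofReal_le_ofReal_iff (by positivity)] at this

theorem sq_v_le_toReal (h : IsModalSolution P 𝓕 W a b T u v R C) (k : ℕ+) (t : ℝ) (ω : Ω) :
    v k t ω ^ 2 ≤ (R k ω).toReal := by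
  have := h.sq_v_le k t ω
  rwa [ENNReal.ofReal_le_iff_le_toReal (h.R_ne_top k ω)] at this

theorem summable_sq_u (h : IsModalSolution P 𝓕 W a b T u v R C) (t : ℝ) (ω : Ω) :
    Summable fun k => u k t ω ^ 2 :=
  Summable.of_nonneg_of_le (fun _ => sq_nonneg _) (fun k => h.sq_u_le_toReal k t ω)
    (h.summable_R ω)

theorem rpow_neg_two (k : ℕ+) : (k : ℝ) ^ (2 * (-1 : ℝ)) = ((k : ℝ) ^ 2)⁻¹ := by
  rw [mul_neg_one, Real.rpow_neg (Nat.cast_nonneg _)]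
  norm_cast

theorem sobolevNormSq_v_lt_top (h : IsModalSolution P 𝓕 W a b T u v R C) (t : ℝ) (ω : Ω) :
    sobolevNormSq (-1) (fun k => v k t ω) < ∞ := by
  unfold sobolevNormSq
  refine lt_of_le_of_lt (ENNReal.tsum_le_tsum fun k => ?_) (h.tsum_ne_top ω).lt_top
  rw [rpow_neg_two, ENNReal.ofReal_mul (by positivity)]
  gcongr
  exact h.sq_v_le k t ω

/-- The position, with values in `L₂((0, π))`. -/
noncomputable def position (u : ℕ+ → ℝ → Ω → ℝ) (t : ℝ) (ω : Ω) : L2pi :=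
  sineSeries fun k => u k t ω

/-- The velocity, with values in `H⁻¹`. -/
noncomputable def velocity (h : IsModalSolution P 𝓕 W a b T u v R C) (t : ℝ) (ω : Ω) :
    SobolevSpace (-1) :=
  ⟨fun k => v k t ω, h.sobolevNormSq_v_lt_top t ω⟩

theorem sineCoeff_position (h : IsModalSolution P 𝓕 W a b T u v R C) (t : ℝ) (ω : Ω) :
    sineCoeff (position u t ω) = fun k => u k t ω := by
  ext k
  exact sineCoeff_sineSeries (h.summable_sq_u t ω) k

theorem coeff_velocity (h : IsModalSolution P 𝓕 W a b T u v R C) (t : ℝ) (ω : Ω) :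
    (h.velocity t ω).coeff = fun k => v k t ω := rfl

theorem measurable_u_uncurry (h : IsModalSolution P 𝓕 W a b T u v R C) (k : ℕ+) :
    Measurable fun p : Ω × ℝ => u k p.2 p.1 :=
  (measurable_uncurry_of_continuous_of_measurable (h.continuous_u k)
    (h.measurable_u k)).comp measurable_swap

theorem measurable_v_uncurry (h : IsModalSolution P 𝓕 W a b T u v R C) (k : ℕ+) :
    Measurable fun p : Ω × ℝ => v k p.2 p.1 :=
  (measurable_uncurry_of_continuous_of_measurable (h.continuous_v k)
    (h.measurable_v k)).comp measurable_swap

theorem memL2Sobolev_position [SFinite P] (h : IsModalSolution P 𝓕 W a b T u v R C) {γ : ℝ}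
    (hγ : γ < 1 / 2) : MemL2Sobolev P T γ fun t ω => sineCoeff (position u t ω) := by
  simp only [h.sineCoeff_position]
  refine memL2Sobolev_of_sq_le (δ := 1) h.measurable_u_uncurry h.measurable_R h.lintegral_R
    h.const_ne_top (fun k t ω => ?_) (by linarith)
  have e : (-2 * 1 : ℝ) = 2 * -1 := by norm_num
  rw [e, rpow_neg_two]
  exact h.sq_u_le k t ω

theorem memL2Sobolev_velocity [SFinite P] (h : IsModalSolution P 𝓕 W a b T u v R C) {γ : ℝ}
    (hγ : γ < 1 / 2) : MemL2Sobolev P T (γ - 1) fun t ω => (h.velocity t ω).coeff := by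
  refine memL2Sobolev_of_sq_le (δ := 0) h.measurable_v_uncurry h.measurable_R h.lintegral_R
    h.const_ne_top (fun k t ω => ?_) (by linarith)
  simpa [h.coeff_velocity] using h.sq_v_le k t ω

theorem memLp_position [SFinite P] (h : IsModalSolution P 𝓕 W a b T u v R C) :
    MemLp (fun p : Ω × ℝ => position u p.2 p.1) 2 (timeMeasure P T) := by
  have hm : AEStronglyMeasurable (fun p : Ω × ℝ => position u p.2 p.1) (timeMeasure P T) :=
    (stronglyMeasurable_sineSeries h.measurable_u_uncurry
      fun p => h.summable_sq_u p.2 p.1).aestronglyMeasurable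
  rw [memLp_two_iff_integrable_sq_norm hm]
  refine ⟨hm.norm.pow 2, ?_⟩
  rw [hasFiniteIntegral_iff_ofReal (Filter.Eventually.of_forall fun p => sq_nonneg _)]
  refine lt_of_le_of_lt (lintegral_mono fun p => ?_)
    (h.memL2Sobolev_position (γ := 0) (by norm_num)).2
  simp only [sobolevNormSq, mul_zero, Real.rpow_zero, one_mul]
  rw [← (hasSum_sineCoeff_sq (position u p.2 p.1)).tsum_eq,
    ENNReal.ofReal_tsum_of_nonneg (fun k => sq_nonneg _) (hasSum_sineCoeff_sq _).summable]

theorem hasSum_noise (h : IsModalSolution P 𝓕 W a b T u v R C)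
    (hW : IsCylindricalBrownianMotion P 𝓕 W) {f : ℝ → ℝ} (hf : IsTestFunction f) (hT : 0 ≤ T) :
    ∀ᵐ ω ∂P, ∀ t : ℝ≥0, (t : ℝ) ≤ T →
      HasSum (fun k => sineCoeff f k * W (sineL2 k) t ω) (W hf.toL2 t ω) := by
  have hsum : HasSum (fun k => sineCoeff f k • sineL2 k) hf.toL2 := by
    have := hasSum_sineCoeff_smul hf.toL2
    rwa [IsTestFunction.toL2, sineCoeff_toLp] at this
  have key := hW.ae_forall_hasSum hsum (T := T.toNNReal) ?_
  · filter_upwards [key] with ω hω t ht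
    exact hω t (by rwa [← NNReal.coe_le_coe, Real.coe_toNNReal T hT])
  · filter_upwards [h.equations] with ω hω
    refine ⟨_, hf.summable_mul_sq.add (h.summable_R ω), fun k t ht => ?_⟩
    rw [← NNReal.coe_le_coe, Real.coe_toNNReal T hT] at ht
    have := (hω k t ⟨t.coe_nonneg, ht⟩).2.2
    rw [Real.toNNReal_coe, ENNReal.ofReal_le_iff_le_toReal (h.R_ne_top k ω)] at this
    exact abs_mul_le_inv_sq_mul this _ _

theorem hasSum_duality (h : IsModalSolution P 𝓕 W a b T u v R C) {f : ℝ → ℝ}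
    (hf : IsTestFunction f) (t : ℝ) (ω : Ω) :
    HasSum (fun k => sineCoeff f k * v k t ω) (duality (h.velocity t ω).coeff f) := by
  have : Summable fun k => sineCoeff f k * v k t ω :=
    Summable.of_norm_bounded (hf.summable_mul_sq.add (h.summable_R ω)) fun k =>
      abs_mul_le_inv_sq_mul (h.sq_v_le_toReal k t ω) _ _
  simpa only [duality, h.coeff_velocity, mul_comm] using this.hasSum

theorem hasSum_position (h : IsModalSolution P 𝓕 W a b T u v R C) {f : ℝ → ℝ}
    (hf : ContinuousOn f (Icc 0 Real.pi)) (t : ℝ) (ω : Ω) :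
    HasSum (fun k => sineCoeff f k * u k t ω)
      (∫ x in Ioo (0 : ℝ) Real.pi, position u t ω x * f x) := by
  have := hasSum_sineCoeff_mul_of_memLp (position u t ω) (memLp_of_continuousOn hf)
  simpa only [h.sineCoeff_position, mul_comm] using this

/-- Each equation is the sum over `k` of the modal equation times `f_k`. The majorants do not depend
on time, so dominated convergence exchanges sum and integral for all `t` outside one null set. -/
theorem isWeakSolution [SFinite P] (h : IsModalSolution P 𝓕 W a b T u v R C)
    (hW : IsCylindricalBrownianMotion P 𝓕 W) (hT : 0 ≤ T) :
    IsWeakSolution P 𝓕 W a b T (position u) h.velocity where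
  adapted_u t ht :=
    @stronglyMeasurable_sineSeries Ω (𝓕 t) (fun ω k => u k t ω) (fun k => h.adapted_u k t ht)
      (h.summable_sq_u t)
  adapted_v t ht k := h.adapted_v k t ht
  memL2_u := h.memLp_position
  memL2_v := by simpa using h.memL2Sobolev_velocity (γ := 0) (by norm_num)
  equations f hf := by
    filter_upwards [h.equations, h.hasSum_noise hW hf hT] with ω heq hnoise t ht
    have ht' : (t : ℝ) ∈ Icc 0 T := ⟨t.coe_nonneg, ht⟩
    have bv : ∀ k s, |sineCoeff f k * v k s ω|
        ≤ (k * sineCoeff f k) ^ 2 + ((k : ℝ) ^ 2)⁻¹ * (R k ω).toReal := fun k s =>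
      abs_mul_le_inv_sq_mul (h.sq_v_le_toReal k s ω) _ _
    have bu : ∀ k s, |sineCoeff (secondDeriv f) k * u k s ω|
        ≤ sineCoeff (secondDeriv f) k ^ 2 + ((k : ℝ) ^ 2)⁻¹ * (R k ω).toReal := fun k s =>
      (abs_mul_le_sq_add_sq _ _).trans (by have := h.sq_u_le_toReal k s ω; gcongr)
    have sv := hf.summable_mul_sq.add (h.summable_R ω)
    have su := (summable_sineCoeff_sq (memLp_of_continuousOn hf.continuousOn_secondDeriv)).add
      (h.summable_R ω)
    have cu := fun k => h.continuous_u k ω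
    have cv := fun k => h.continuous_v k ω
    constructor
    · have h1 := intervalIntegral.hasSum_integral_of_dominated_convergence (μ := volume)
        (a := 0) (b := (t : ℝ)) (F := fun k s => sineCoeff f k * v k s ω)
        (fun k _ => (k * sineCoeff f k) ^ 2 + ((k : ℝ) ^ 2)⁻¹ * (R k ω).toReal)
        (fun k => ((cv k).const_mul _).aestronglyMeasurable)
        (fun k => Filter.Eventually.of_forall fun s _ => bv k s)
        (Filter.Eventually.of_forall fun s _ => sv) intervalIntegrable_const
        (Filter.Eventually.of_forall fun s _ => h.hasSum_duality hf s ω)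
      refine (h.hasSum_position hf.contDiffOn.continuousOn t ω).unique (h1.congr_fun fun k => ?_)
      rw [intervalIntegral.integral_const_mul, ← (heq k t ht').1]
    · have h1 := intervalIntegral.hasSum_integral_of_dominated_convergence (μ := volume)
        (a := 0) (b := (t : ℝ))
        (F := fun k s => a ^ 2 * (sineCoeff (secondDeriv f) k * u k s ω)
          - 2 * b * (sineCoeff f k * v k s ω))
        (fun k _ =>
          a ^ 2 * (sineCoeff (secondDeriv f) k ^ 2 + ((k : ℝ) ^ 2)⁻¹ * (R k ω).toReal)
          + |2 * b| * ((k * sineCoeff f k) ^ 2 + ((k : ℝ) ^ 2)⁻¹ * (R k ω).toReal))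
        (fun k => ((((cu k).const_mul _).const_mul _).sub
          (((cv k).const_mul _).const_mul _)).aestronglyMeasurable)
        (fun k => Filter.Eventually.of_forall fun s _ => by
          refine (norm_sub_le _ _).trans ?_
          rw [norm_mul, norm_mul (2 * b), Real.norm_of_nonneg (sq_nonneg a)]
          exact add_le_add (mul_le_mul_of_nonneg_left (bu k s) (sq_nonneg a))
            (mul_le_mul_of_nonneg_left (bv k s) (abs_nonneg _)))
        (Filter.Eventually.of_forall fun s _ => (su.mul_left _).add (sv.mul_left _))
        intervalIntegrable_const
        (Filter.Eventually.of_forall fun s _ =>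
          ((h.hasSum_position hf.continuousOn_secondDeriv s ω).mul_left (a ^ 2)).sub
            ((h.hasSum_duality hf s ω).mul_left (2 * b)))
      refine (h.hasSum_duality hf t ω).unique
        ((h1.add (hnoise t ht)).congr_fun fun k => ?_)
      rw [(heq k t ht').2.1, Real.toNNReal_coe, mul_add, ← intervalIntegral.integral_const_mul]
      congr 1
      refine intervalIntegral.integral_congr fun s _ => ?_
      simp only [hf.sineCoeff_secondDeriv]
      ring

end IsModalSolution

end StochWave

/-! ### Existence, uniqueness and regularity -/

theorem theorem2p1 {Ω : Type*} {m : MeasurableSpace Ω} (P : Measure Ω) [IsProbabilityMeasure P]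
    (𝓕 : Filtration ℝ≥0 m) (h𝓕 : StochWave.UsualConditions P 𝓕)
    (W : StochWave.L2pi → ℝ≥0 → Ω → ℝ) (hW : StochWave.IsCylindricalBrownianMotion P 𝓕 W)
    (a b T : ℝ) (ha : 1 ≤ a) (hb : 2 * |b| ≤ 1) (hT : 0 < T) :
    ∃ (u : ℝ → Ω → StochWave.L2pi) (v : ℝ → Ω → StochWave.SobolevSpace (-1)),
      StochWave.IsWeakSolution P 𝓕 W a b T u v ∧
      (∀ (u' : ℝ → Ω → StochWave.L2pi) (v' : ℝ → Ω → StochWave.SobolevSpace (-1)),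
        StochWave.IsWeakSolution P 𝓕 W a b T u' v' →
          ∀ᵐ ω ∂P, ∀ t ∈ Icc 0 T, u' t ω = u t ω ∧ v' t ω = v t ω) ∧
      ∀ γ : ℝ, γ < 1 / 2 →
        StochWave.MemL2Sobolev P T γ (fun t ω => StochWave.sineCoeff (u t ω)) ∧
        StochWave.MemL2Sobolev P T (γ - 1) (fun t ω => (v t ω).coeff) := by
  obtain ⟨u, v, R, C, h⟩ := StochWave.exists_isModalSolution h𝓕 hW ha hb hT
  have hsol := h.isWeakSolution hW hT.le
  exact ⟨StochWave.IsModalSolution.position u, h.velocity, hsol,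
    fun u' v' h' => hsol.ae_eq h' hT.le,
    fun γ hγ => ⟨h.memL2Sobolev_position hγ, h.memL2Sobolev_velocity hγ⟩⟩
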